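/- Let $M\ge 1$ be an integer and write $M=2k$ or $M=2k+1$. On $\{0,\dots,M\}^{\infty}$ let $\sigma$ be the left shift, $\overline{(c_i)}=(M-c_i)$ the reflection, and $\prec,\preccurlyeq$ the lexicographic order. For a word $w$ of length $j$, $\overline w$ is its digitwise reflection, and $w^-$, $w^+$ denote $w$ with its last digit lowered, respectively raised, by one. For $q\in(1,M+1]$ let $\alpha(q)$ be the quasi-greedy $q$-expansion of $1$, i.e. the lexicographically largest sequence $(c_i)$ with $\sum_{i\ge1}c_iq^{-i}=1$ that does not end in $0^\infty$. Put $$\mathbf V_q=\{(x_i):\overline{\alpha(q)}\preccurlyeq\sigma^n((x_i))\preccurlyeq\alpha(q)\ \forall n\ge0\},\qquad \mathbf V=\{(a_i):\overline{(a_i)}\preccurlyeq\sigma^n((a_i))\preccurlyeq(a_i)\ \forall n\ge0\},$$ and $\mathcal V=\{q\in(1,M+1]:\alpha(q)\in\mathbf V\}$. Let $q_G=k+1$ if $M=2k$ and $q_G=\frac{k+1+\sqrt{k^2+6k+5}}2$ if $M=2k+1$. A sequence $(a_i)\in\mathbf V$ is irreducible if $a_1\ldots a_j(\overline{a_1\ldots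 a_j}\,^+)^\infty\prec(a_i)$ for every $j\ge1$ with $a_j>0$ and $(a_1\ldots a_j^-)^\infty\in\mathbf V$. A set of sequences is a subshift if it consists of all sequences avoiding some set of forbidden words. The language $\mathcal L(X)$ of a set $X$ of sequences consists of the finite words occurring in elements of $X$ and the empty word; $(X,\sigma)$ is transitive if for all $\omega,\nu\in\mathcal L(X)$ there is $\delta\in\mathcal L(X)$ with $\omega\delta\nu\in\mathcal L(X)$. For $q\in[q_G,M+1]$ the set $\mathbf V_q$ is a nonempty subshift, and $\mathbf V_q=\emptyset$ for $q\in(1,q_G)$. There is a unique $q_T\in(1,M+1]$ (the transitive base) with $\alpha(q_T)=(k+1)k^\infty$ if $M=2k$ and $\alpha(q_T)=(k+1)((k+1)k)^\infty$ if $M=2k+1$. For every $q\in[q_G,M+1]\cap\mathcal V$, $$(\mathbf V_q,\sigma)\text{ is transitive}\iff\alpha(q)\text{ is irreducible or }q=q_T .$$ Moreover, for every $q\in[q_G,M+1]$ the set $\mathcal V\cap[q_G,q]$ has a greatest element $p$, and $\mathbf V_q=\mathbf V_p$; hence $(\mathbf V_q,\sigma)$ is transitive if and only if $\alpha(p)$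 is irreducible or $p=q_T$. -/

import Mathlib

open Set

namespace UniqueExpansion

/-- One-sided sequences over the alphabet `{0, 1, ..., M}`;
the sequence `c₁ c₂ ...` is stored as `c 0, c 1, ...`. -/
abbrev Seqs (M : ℕ) := ℕ → Fin (M + 1)

/-- Finite words over the alphabet `{0, 1, ..., M}`. -/
abbrev Word (M : ℕ) := List (Fin (M + 1))

/-- The natural number `n`, read as a digit (truncated at `M`, used only for `n ≤ M`). -/
def digit (M n : ℕ) : Fin (M + 1) := ⟨min n M, by omega⟩

/-- Strict lexicographic order on sequences. -/
def LexLt {M : ℕ} (c d : Seqs M) : Prop := toLex c < toLex d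

/-- Lexicographic order on sequences. -/
def LexLe {M : ℕ} (c d : Seqs M) : Prop := toLex c ≤ toLex d

/-- `σⁿ(c)`, the `n`-fold left shift. -/
def shift {M : ℕ} (n : ℕ) (c : Seqs M) : Seqs M := fun i => c (n + i)

/-- The reflection `(M - c₁)(M - c₂)...` of a sequence. -/
def reflSeq {M : ℕ} (c : Seqs M) : Seqs M := fun i => (c i).rev

/-- The reflection of a word. -/
def reflWord {M : ℕ} (w : Word M) : Word M := w.map Fin.rev

/-- `w⁻`: the last digit is lowered by one (meaningful if it is positive). -/
def wordMinus {M : ℕ} (w : Word M) : Word M :=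
  w.set (w.length - 1) (digit M ((w.getD (w.length - 1) 0 : ℕ) - 1))

/-- `w⁺`: the last digit is raised by one (meaningful if it is less than `M`). -/
def wordPlus {M : ℕ} (w : Word M) : Word M :=
  w.set (w.length - 1) (digit M ((w.getD (w.length - 1) 0 : ℕ) + 1))

/-- `w^∞`, the infinite concatenation of a nonempty word with itself. -/
def periodic {M : ℕ} (w : Word M) : Seqs M := fun i => w.getD (i % w.length) 0

/-- The concatenation of a word and a sequence. -/
def append {M : ℕ} (w : Word M) (c : Seqs M) : Seqs M :=
  fun i => if i < w.length then w.getD i 0 else c (i - w.length)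

/-- The prefix `c₁ ... c_j`. -/
def pre {M : ℕ} (c : Seqs M) (j : ℕ) : Word M := (List.range j).map c

/-- `c` is an expansion of `x` in base `q`: `x = ∑_{i ≥ 1} c_i / q^i`. -/
def IsExpansion (M : ℕ) (q x : ℝ) (c : Seqs M) : Prop :=
  HasSum (fun i : ℕ => ((c i : ℕ) : ℝ) / q ^ (i + 1)) x

/-- A sequence is infinite if it does not end with an infinite string of zeros. -/
def IsInfinite {M : ℕ} (c : Seqs M) : Prop := ∀ N, ∃ n, N ≤ n ∧ c n ≠ 0

/-- `c` is the lexicographically largest infinite expansion of `1` in base `q`. -/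
def IsQuasiGreedy (M : ℕ) (q : ℝ) (c : Seqs M) : Prop :=
  IsExpansion M q 1 c ∧ IsInfinite c ∧
    ∀ d : Seqs M, IsExpansion M q 1 d → IsInfinite d → LexLe d c

open Classical in
/-- The quasi-greedy expansion `α(q)` of `1` (it exists for every `1 < q ≤ M + 1`, and is
unique). -/
noncomputable def alpha (M : ℕ) (q : ℝ) : Seqs M :=
  if h : ∃ c : Seqs M, IsQuasiGreedy M q c then h.choose else fun _ => 0

/-- The sequences all of whose shifts lie between the reflection of `a` and `a`. -/
def between {M : ℕ} (a : Seqs M) : Set (Seqs M) :=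
  {c | ∀ n, LexLe (reflSeq a) (shift n c) ∧ LexLe (shift n c) a}

/-- The set of sequences written as a bold `V_q`. -/
def VShift (M : ℕ) (q : ℝ) : Set (Seqs M) := between (alpha M q)

/-- The set of sequences written as a bold `V` (without index). -/
def VSeqs (M : ℕ) : Set (Seqs M) := {a | a ∈ between a}

/-- The set of bases written as a calligraphic `V`. -/
def VBases (M : ℕ) : Set ℝ := {q | q ∈ Ioc (1 : ℝ) (M + 1) ∧ alpha M q ∈ VSeqs M}

/-- The word `w` occurs in the sequence `c`. -/
def Occurs {M : ℕ} (w : Word M) (c : Seqs M) : Prop := ∃ n, pre (shift n c) w.length = w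

/-- A subshift is a set of sequences given by a set of forbidden words. -/
def IsSubshift {M : ℕ} (X : Set (Seqs M)) : Prop :=
  ∃ F : Set (Word M), X = {c | ∀ w ∈ F, ¬ Occurs w c}

/-- The language of `X`: all finite words occurring in elements of `X`, and the empty word. -/
def language {M : ℕ} (X : Set (Seqs M)) : Set (Word M) :=
  {w | w = [] ∨ ∃ c ∈ X, Occurs w c}

/-- Topological transitivity of `(X, σ)`. -/
def IsTransitive {M : ℕ} (X : Set (Seqs M)) : Prop :=
  ∀ w ∈ language X, ∀ v ∈ language X, ∃ u ∈ language X, w ++ u ++ v ∈ language X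

/-- Irreducible sequences. Here `j = i + 1 ≥ 1`, and `a i` is the `j`-th digit, which has to be
positive for `(a₁ ... a_j)⁻` to be defined. -/
def IsIrreducibleSeq {M : ℕ} (a : Seqs M) : Prop :=
  a ∈ VSeqs M ∧ ∀ i : ℕ, 0 < a i →
    periodic (wordMinus (pre a (i + 1))) ∈ VSeqs M →
    LexLt (append (pre a (i + 1)) (periodic (wordPlus (reflWord (pre a (i + 1)))))) a

/-- The generalized golden ratio. -/
noncomputable def qG (M : ℕ) : ℝ :=
  if Even M then ((M / 2 : ℕ) : ℝ) + 1
  else (((M / 2 : ℕ) : ℝ) + 1 +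
    Real.sqrt (((M / 2 : ℕ) : ℝ) ^ 2 + 6 * ((M / 2 : ℕ) : ℝ) + 5)) / 2

/-- The sequence that defines the transitive base: `(k+1) k^∞` if `M = 2k`, and
`(k+1) ((k+1) k)^∞` if `M = 2k + 1`. -/
def transitiveSeq (M : ℕ) : Seqs M :=
  if Even M then append [digit M (M / 2 + 1)] (periodic [digit M (M / 2)])
  else append [digit M (M / 2 + 1)] (periodic [digit M (M / 2 + 1), digit M (M / 2)])

end UniqueExpansion

open UniqueExpansion

/-!
All sets of sequences in the theorem have the form `between a`, and the theorem splits into a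
combinatorial part about these sets and an analytic part about the map `q ↦ alpha M q`.

**Analytic part.** `alpha M q` is produced by the quasi-greedy algorithm, which gives existence
and strict monotonicity in `q` (`alpha_lt_alpha`). If all shifts of an infinite sequence are at most
the sequence itself, then it is `alpha M q` for the base `q` in which it represents `1`
(`alpha_eq_of_value_eq_one`); in particular every element of `VSeqs M` is some `alpha M q`
(`exists_alpha_eq`). The base `qG M` belongs to the smallest element `golden M` of `VSeqs M`, below
which `between a` is empty. For any nonempty `between a`, the largest element `b` of it lies
in `VSeqs M` and has `between b = between a` (`exists_VSeqs_between_eq`), and the base of `b` is the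
greatest element asked for.

**Transitivity for irreducible `a`.** Say that a prefix of `a` is good if it can be continued,
within `between a`, to end with any given element of `between a`. If all prefixes of `a` are good,
`between a` is transitive, because after any word only its longest suffix that is a prefix of `a` or
of the reflection of `a` restricts the continuation (`good_of_suffix`). That the prefix of length
`n` is good is shown by strong induction on `n`. If no proper suffix of it is a prefix of the
reflection of `a`, then `(a₀ ... aₙ₋₁⁻)^∞` is in `VSeqs M`, and by irreducibility
`a₀ ... aₙ₋₁` may be followed by copies of the reflection of `a₀ ... aₙ₋₁⁻`; after these the
longest relevant suffix is shorter than `n` (`IsIrreducibleSeq.good_of_not_agree`). Otherwise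
irreducibility at the beginning of the longest such suffix bounds the length of the match, and one
leaves `a` there, following the reflection of `a` (`IsIrreducibleSeq.good_of_agree`). The sequence
`transitiveSeq M`, which is not irreducible, is treated by hand (`good_transitiveSeq`).

**Failure of transitivity.** If irreducibility fails at `w = a₀ ... aᵢ`, then an element of
`between a` beginning with `w` is a concatenation of the blocks `w`, `w⁻` and their reflections, in
which `w` and the reflection of `w⁻` cannot be followed by anything else than the reflections of `w`
and `w⁻` (`comparison_blocks`). So long pieces of `golden M` do not occur after `w`, unless `w⁻` is
a period of `golden M` and `a = transitiveSeq M` (`not_isTransitive_of_comparison`,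
`splice_eq_transitiveSeq`).
-/

namespace UniqueExpansion

variable {M : ℕ}

/-! ### The lexicographic order -/

/-- `c` is lexicographically smaller than `d`, and the first difference is among the first `n`
digits. In contrast to `LexLt` this depends on finitely many digits only. -/
def LtIn (n : ℕ) (c d : Seqs M) : Prop := ∃ i < n, (∀ j < i, c j = d j) ∧ c i < d i

/-- `c` and `d` have the same first `n` digits. -/
def Agree (n : ℕ) (c d : Seqs M) : Prop := ∀ i < n, c i = d i

theorem Agree.symm {n : ℕ} {c d : Seqs M} (h : Agree n c d) : Agree n d c :=
  fun i hi => (h i hi).symm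

theorem Agree.mono {m n : ℕ} {c d : Seqs M} (h : Agree n c d) (hm : m ≤ n) : Agree m c d :=
  fun i hi => h i (by omega)

theorem Agree.reflSeq {n : ℕ} {c d : Seqs M} (h : Agree n c d) :
    Agree n (reflSeq c) (reflSeq d) := fun i hi => by simp [UniqueExpansion.reflSeq, h i hi]

theorem Agree.shift {n r : ℕ} {c d : Seqs M} (h : Agree n c d) :
    Agree (n - r) (shift r c) (shift r d) := fun i hi => h (r + i) (by omega)

theorem lexLt_iff {c d : Seqs M} : LexLt c d ↔ ∃ i, (∀ j < i, c j = d j) ∧ c i < d i := Iff.rfl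

theorem lexLt_iff_exists_ltIn {c d : Seqs M} : LexLt c d ↔ ∃ n, LtIn n c d := by
  rw [lexLt_iff]
  constructor
  · rintro ⟨i, h⟩
    exact ⟨i + 1, i, by omega, h⟩
  · rintro ⟨n, i, -, h⟩
    exact ⟨i, h⟩

theorem LtIn.lexLt {n : ℕ} {c d : Seqs M} (h : LtIn n c d) : LexLt c d :=
  lexLt_iff_exists_ltIn.2 ⟨n, h⟩

theorem LexLt.le {c d : Seqs M} (h : LexLt c d) : LexLe c d := le_of_lt h

theorem LtIn.le {n : ℕ} {c d : Seqs M} (h : LtIn n c d) : LexLe c d := h.lexLt.le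

theorem lexLe_refl (c : Seqs M) : LexLe c c := le_refl (toLex c)

theorem LexLe.trans {c d e : Seqs M} (h : LexLe c d) (h' : LexLe d e) : LexLe c e :=
  le_trans h h'

theorem LexLe.trans_lt {c d e : Seqs M} (h : LexLe c d) (h' : LexLt d e) : LexLt c e :=
  lt_of_le_of_lt h h'

theorem LexLe.antisymm {c d : Seqs M} (h : LexLe c d) (h' : LexLe d c) : c = d :=
  toLex.injective (le_antisymm h h')

theorem LexLe.eq_or_lt {c d : Seqs M} (h : LexLe c d) : c = d ∨ LexLt c d :=
  (eq_or_lt_of_le h).imp_left fun h => toLex.injective h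

theorem LexLe.lt_of_ne {c d : Seqs M} (h : LexLe c d) (h' : c ≠ d) : LexLt c d :=
  h.eq_or_lt.resolve_left h'

theorem lexLe_total (c d : Seqs M) : LexLe c d ∨ LexLe d c := le_total (toLex c) (toLex d)

theorem not_lexLe {c d : Seqs M} : ¬ LexLe c d ↔ LexLt d c := not_le

theorem LtIn.not_le {n : ℕ} {c d : Seqs M} (h : LtIn n c d) : ¬ LexLe d c :=
  not_lexLe.2 h.lexLt

theorem LtIn.mono {m n : ℕ} {c d : Seqs M} (h : LtIn m c d) (hm : m ≤ n) : LtIn n c d := by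
  obtain ⟨i, hi, h⟩ := h
  exact ⟨i, by omega, h⟩

theorem ltIn_of_zero_lt {n : ℕ} {c d : Seqs M} (h : c 0 < d 0) (hn : 0 < n) : LtIn n c d :=
  ⟨0, hn, by simp, h⟩

theorem LtIn.congr {n : ℕ} {c d c' d' : Seqs M} (h : LtIn n c d) (hc : Agree n c c')
    (hd : Agree n d d') : LtIn n c' d' := by
  obtain ⟨i, hi, h1, h2⟩ := h
  refine ⟨i, hi, fun j hj => ?_, ?_⟩
  · rw [← hc j (by omega), ← hd j (by omega)]
    exact h1 j hj
  · rwa [← hc i hi, ← hd i hi]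

theorem LtIn.not_agree {n : ℕ} {c d : Seqs M} (h : LtIn n c d) : ¬ Agree n c d := by
  obtain ⟨i, hi, -, h2⟩ := h
  exact fun h => h2.ne (h i hi)

theorem LexLe.ltIn_of_not_agree {n : ℕ} {c d : Seqs M} (h : LexLe c d) (hn : ¬ Agree n c d) :
    LtIn n c d := by
  rcases h.eq_or_lt with rfl | ⟨i, h1, h2⟩
  · exact absurd (fun i _ => rfl) hn
  · refine ⟨i, ?_, h1, h2⟩
    by_contra hi
    exact hn fun j hj => h1 j (by omega)

theorem LtIn.trans_le {n : ℕ} {c d e : Seqs M} (h : LtIn n c d) (h' : LexLe d e) :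
    LtIn n c e := by
  refine (h.le.trans h').ltIn_of_not_agree fun hce => ?_
  have : LtIn n e d := h.congr hce (fun _ _ => rfl)
  exact this.not_le h'

theorem LexLe.trans_ltIn {n : ℕ} {c d e : Seqs M} (h : LexLe c d) (h' : LtIn n d e) :
    LtIn n c e := by
  refine (h.trans h'.le).ltIn_of_not_agree fun hce => ?_
  have : LtIn n d c := h'.congr (fun _ _ => rfl) hce.symm
  exact this.not_le h

@[simp] theorem reflSeq_reflSeq (c : Seqs M) : reflSeq (reflSeq c) = c := by
  funext i
  simp [reflSeq]

@[simp] theorem shift_zero (c : Seqs M) : shift 0 c = c := by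
  funext i
  simp [shift]

theorem shift_shift (m n : ℕ) (c : Seqs M) : shift m (shift n c) = shift (n + m) c := by
  funext i
  simp [shift, add_assoc]

theorem shift_reflSeq (n : ℕ) (c : Seqs M) : shift n (reflSeq c) = reflSeq (shift n c) := rfl

theorem LtIn.reflSeq {n : ℕ} {c d : Seqs M} (h : LtIn n c d) :
    LtIn n (reflSeq d) (reflSeq c) := by
  obtain ⟨i, hi, h1, h2⟩ := h
  exact ⟨i, hi, fun j hj => by simp [UniqueExpansion.reflSeq, h1 j hj],
    by simpa [UniqueExpansion.reflSeq] using h2⟩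

theorem LexLe.reflSeq {c d : Seqs M} (h : LexLe c d) : LexLe (reflSeq d) (reflSeq c) := by
  rcases h.eq_or_lt with rfl | h
  · exact lexLe_refl _
  · obtain ⟨n, hn⟩ := lexLt_iff_exists_ltIn.1 h
    exact hn.reflSeq.le

theorem LexLe.zero_le {c d : Seqs M} (h : LexLe c d) : c 0 ≤ d 0 := by
  by_contra h0
  exact (ltIn_of_zero_lt (n := 1) (not_le.1 h0) one_pos).not_le h

theorem LexLe.one_le {c d : Seqs M} (h : LexLe c d) (h0 : c 0 = d 0) : c 1 ≤ d 1 := by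
  by_contra h1
  refine LtIn.not_le (n := 2) ⟨1, by omega, fun j hj => ?_, not_le.1 h1⟩ h
  obtain rfl : j = 0 := by omega
  exact h0.symm

/-- Cancelling a common prefix. -/
theorem LexLe.shift {n : ℕ} {c d : Seqs M} (h : LexLe c d) (hn : Agree n c d) :
    LexLe (shift n c) (shift n d) := by
  rcases h.eq_or_lt with rfl | ⟨i, h1, h2⟩
  · exact lexLe_refl _
  · have hi : n ≤ i := by
      by_contra hi
      exact h2.ne (hn i (by omega))
    refine LexLt.le ⟨i - n, fun j hj => h1 (n + j) (by omega), ?_⟩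
    have e : n + (i - n) = i := by omega
    simpa [UniqueExpansion.shift, e] using h2

theorem LtIn.shift {n N : ℕ} {c d : Seqs M} (h : LtIn N c d) (hn : Agree n c d) :
    LtIn (N - n) (shift n c) (shift n d) := by
  obtain ⟨i, hi, h1, h2⟩ := h
  have hi' : n ≤ i := by
    by_contra hi
    exact h2.ne (hn i (by omega))
  refine ⟨i - n, by omega, fun j hj => h1 (n + j) (by omega), ?_⟩
  have e : n + (i - n) = i := by omega
  simpa [UniqueExpansion.shift, e] using h2

/-- Cancelling only a part of the common prefix. -/
theorem LtIn.shift_of_agree {l r N : ℕ} {c d : Seqs M} (h : LtIn N c d) (hl : Agree l c d)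
    (hr : r ≤ l) : LtIn (N - r) (UniqueExpansion.shift r c) (UniqueExpansion.shift r d) :=
  h.shift (hl.mono hr)

theorem lexLe_of_agree_of_shift {n : ℕ} {c d : Seqs M} (hn : Agree n c d)
    (h : LexLe (shift n c) (shift n d)) : LexLe c d := by
  by_contra hc
  obtain ⟨N, hN⟩ := lexLt_iff_exists_ltIn.1 (not_lexLe.1 hc)
  exact (hN.shift hn.symm).not_le h

/-! ### The sets `between a` -/

theorem between_mono {a b : Seqs M} (h : LexLe a b) : between a ⊆ between b :=
  fun _ hc n => ⟨h.reflSeq.trans (hc n).1, (hc n).2.trans h⟩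

theorem shift_mem_between {a c : Seqs M} (h : c ∈ between a) (n : ℕ) : shift n c ∈ between a := by
  intro m
  rw [shift_shift]
  exact h _

theorem reflSeq_mem_between {a c : Seqs M} (h : c ∈ between a) : reflSeq c ∈ between a := by
  intro n
  refine ⟨(h n).2.reflSeq, ?_⟩
  have := (h n).1.reflSeq
  rwa [reflSeq_reflSeq] at this

/-! ### Splicing sequences -/

/-- The first `n` digits of `y`, followed by `d`. -/
def splice (y : Seqs M) (n : ℕ) (d : Seqs M) : Seqs M := fun i => if i < n then y i else d (i - n)

theorem splice_agree (y : Seqs M) (n : ℕ) (d : Seqs M) : Agree n (splice y n d) y :=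
  fun i hi => by simp [splice, hi]

@[simp] theorem shift_splice_self (y : Seqs M) (n : ℕ) (d : Seqs M) :
    shift n (splice y n d) = d := by
  funext i
  simp [shift, splice]

theorem shift_splice_of_le {n r : ℕ} (y d : Seqs M) (h : n ≤ r) :
    shift r (splice y n d) = shift (r - n) d := by
  conv_lhs => rw [show r = n + (r - n) by omega, ← shift_shift, shift_splice_self]

theorem shift_splice_of_ge {n r : ℕ} (y d : Seqs M) (h : r ≤ n) :
    shift r (splice y n d) = splice (shift r y) (n - r) d := by
  funext i
  by_cases hi : r + i < n
  · have : i < n - r := by omega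
    simp [shift, splice, hi, this]
  · have : ¬ i < n - r := by omega
    have e : r + i - n = i - (n - r) := by omega
    simp [shift, splice, hi, this, e]

theorem splice_shift (y : Seqs M) (n : ℕ) : splice y n (shift n y) = y := by
  funext i
  by_cases hi : i < n
  · simp [splice, hi]
  · simp [splice, hi, shift, show n + (i - n) = i by omega]

theorem splice_lexLe {n : ℕ} {y d d' : Seqs M} (h : LexLe d d') :
    LexLe (splice y n d) (splice y n d') := by
  refine lexLe_of_agree_of_shift (n := n) (fun i hi => ?_) (by simpa using h)
  rw [splice_agree y n d i hi, splice_agree y n d' i hi]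

theorem splice_congr {n : ℕ} {y y' : Seqs M} (h : Agree n y y') (d : Seqs M) :
    splice y n d = splice y' n d := by
  funext i
  by_cases hi : i < n
  · simp [splice, hi, h i hi]
  · simp [splice, hi]

@[simp] theorem length_pre (c : Seqs M) (n : ℕ) : (pre c n).length = n := by simp [pre]

theorem getD_pre {c : Seqs M} {n i : ℕ} (h : i < n) : (pre c n).getD i 0 = c i := by
  simp [pre, List.getD, h]

theorem append_pre (y : Seqs M) (n : ℕ) (d : Seqs M) : append (pre y n) d = splice y n d := by
  funext i
  by_cases hi : i < n
  · simp only [append, splice, length_pre, hi, if_true, getD_pre]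
  · simp [append, splice, hi]

theorem pre_eq_pre_iff {c d : Seqs M} {n : ℕ} : pre c n = pre d n ↔ Agree n c d := by
  simp [pre, Agree]

theorem pre_add (c : Seqs M) (m n : ℕ) : pre c (m + n) = pre c m ++ pre (shift m c) n := by
  simp only [pre, List.range_add, List.map_append, List.map_map]
  rfl

/-- The sequence `(a₀ ... aᵢ⁻)^∞`. -/
def lowered (a : Seqs M) (i : ℕ) : Seqs M := periodic (wordMinus (pre a (i + 1)))

theorem lowered_of_lt {a : Seqs M} {i r : ℕ} (h : r < i) : lowered a i r = a r := by
  have h1 : r % (i + 1) = r := Nat.mod_eq_of_lt (by omega)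
  have h2 : i ≠ r := by omega
  simp [lowered, periodic, wordMinus, h1, List.getD, h2, pre,
    show r < i + 1 by omega]

theorem lowered_self (a : Seqs M) (i : ℕ) : (lowered a i i : ℕ) = (a i : ℕ) - 1 := by
  have h1 : i % (i + 1) = i := Nat.mod_eq_of_lt (by omega)
  simp [lowered, periodic, wordMinus, h1, List.getD, pre, digit]

theorem shift_lowered (a : Seqs M) (i r : ℕ) :
    shift r (lowered a i) = shift (r % (i + 1)) (lowered a i) := by
  funext j
  simp [shift, lowered, periodic, wordMinus]

theorem shift_lowered_self (a : Seqs M) (i : ℕ) : shift (i + 1) (lowered a i) = lowered a i := by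
  rw [shift_lowered]
  simp

theorem periodic_wordPlus_eq {a : Seqs M} {i : ℕ} (h : 0 < a i) :
    periodic (wordPlus (reflWord (pre a (i + 1)))) = reflSeq (lowered a i) := by
  have h' : 0 < (a i : ℕ) := h
  have := (a i).is_lt
  funext j
  have hj : j % (i + 1) < i + 1 := Nat.mod_lt _ (by omega)
  have e : lowered a i j = lowered a i (j % (i + 1)) := by
    simp [lowered, periodic, wordMinus]
  rw [reflSeq, e]
  rcases Nat.lt_or_ge (j % (i + 1)) i with hr | hr
  · rw [lowered_of_lt hr]
    simp [periodic, wordPlus, reflWord, List.getD, pre, hj,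
      show i ≠ j % (i + 1) by omega]
  · have hr : j % (i + 1) = i := by omega
    rw [hr]
    apply Fin.ext
    rw [Fin.val_rev, lowered_self]
    simp [periodic, wordPlus, reflWord, List.getD, pre, hr, digit]
    omega

theorem IsIrreducibleSeq.splice_lt {a : Seqs M} (h : IsIrreducibleSeq a) {i : ℕ} (hi : 0 < a i)
    (hv : lowered a i ∈ VSeqs M) : LexLt (splice a (i + 1) (reflSeq (lowered a i))) a := by
  have := h.2 i hi hv
  rwa [append_pre, periodic_wordPlus_eq hi] at this

/-! ### The smallest element of `VSeqs M` -/

/-- The smallest element of `VSeqs M`: it is `k^∞` if `M = 2k` and `((k+1)k)^∞` if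
`M = 2k + 1`. -/
def golden (M : ℕ) : Seqs M :=
  fun i => if Even i then digit M ((M + 1) / 2) else digit M (M / 2)

theorem val_golden_zero (M : ℕ) : (golden M 0 : ℕ) = (M + 1) / 2 := by
  simp [golden, digit]
  omega

theorem val_golden_one (M : ℕ) : (golden M 1 : ℕ) = M / 2 := by
  simp [golden, digit]
  omega

theorem golden_succ (i : ℕ) : golden M (i + 1) = (golden M i).rev := by
  apply Fin.ext
  rw [Fin.val_rev]
  by_cases h : Even i <;> simp [golden, h, digit, Nat.even_add_one] <;> omega

theorem shift_one_golden : shift 1 (golden M) = reflSeq (golden M) := by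
  funext i
  simp [shift, reflSeq, add_comm 1 i, golden_succ]

theorem shift_golden (n : ℕ) :
    shift n (golden M) = if Even n then golden M else reflSeq (golden M) := by
  induction n with
  | zero => simp
  | succ n ih =>
    rw [← shift_shift, ih]
    by_cases h : Even n
    · simp [h, Nat.even_add_one, shift_one_golden]
    · simp [h, Nat.even_add_one, shift_reflSeq, shift_one_golden]

theorem eq_golden_or_reflSeq_of_alternating {c : Seqs M} (h : ∀ i, c (i + 1) = (c i).rev) :
    (c 0 = golden M 0 → c = golden M) ∧ (c 0 = (golden M 0).rev → c = reflSeq (golden M)) := by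
  constructor
  · intro h0
    funext i
    induction i with
    | zero => exact h0
    | succ i ih => rw [h, ih, golden_succ]
  · intro h0
    funext i
    induction i with
    | zero => exact h0
    | succ i ih => rw [h, ih, reflSeq, reflSeq, golden_succ]

theorem alternating_of_mem_between_golden {c : Seqs M} (h : c ∈ between (golden M)) :
    (∀ i, c (i + 1) = (c i).rev) ∧ (c 0 = golden M 0 ∨ c 0 = (golden M 0).rev) := by
  have h0 : ∀ i, c i = golden M 0 ∨ c i = (golden M 0).rev := by
    intro i
    have h1 : (golden M 0).rev ≤ c i := (h i).1.zero_le
    have h2 : c i ≤ golden M 0 := (h i).2.zero_le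
    have := val_golden_zero M
    rw [Fin.le_def, Fin.val_rev] at h1
    rw [Fin.le_def] at h2
    rw [Fin.ext_iff, Fin.ext_iff, Fin.val_rev]
    omega
  refine ⟨fun i => ?_, h0 0⟩
  rcases h0 i with hi | hi
  · have h1 : c (i + 1) ≤ golden M 1 := (h i).2.one_le hi
    have h2 := h0 (i + 1)
    have := val_golden_zero M
    have := val_golden_one M
    rw [hi]
    rw [Fin.le_def] at h1
    rw [Fin.ext_iff, Fin.ext_iff, Fin.val_rev] at h2
    rw [Fin.ext_iff, Fin.val_rev]
    omega
  · have h1 : (golden M 1).rev ≤ c (i + 1) := (h i).1.one_le hi.symm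
    have h2 := h0 (i + 1)
    have := val_golden_zero M
    have := val_golden_one M
    rw [hi]
    rw [Fin.le_def, Fin.val_rev] at h1
    rw [Fin.ext_iff, Fin.ext_iff, Fin.val_rev] at h2
    rw [Fin.ext_iff, Fin.rev_rev]
    omega

theorem eq_golden_or_of_mem_between_golden {c : Seqs M} (h : c ∈ between (golden M)) :
    c = golden M ∨ c = reflSeq (golden M) := by
  obtain ⟨h1, h2⟩ := alternating_of_mem_between_golden h
  exact h2.imp (eq_golden_or_reflSeq_of_alternating h1).1 (eq_golden_or_reflSeq_of_alternating h1).2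

theorem reflSeq_golden_le : LexLe (reflSeq (golden M)) (golden M) := by
  rcases lt_or_ge ((golden M 0).rev) (golden M 0) with h | h
  · exact (ltIn_of_zero_lt (n := 1) h one_pos).le
  · have e : golden M 0 = (golden M 0).rev := by
      have := val_golden_zero M
      rw [Fin.le_def, Fin.val_rev] at h
      rw [Fin.ext_iff, Fin.val_rev]
      omega
    have := (eq_golden_or_reflSeq_of_alternating (c := golden M) golden_succ).2 e
    rw [← this]
    exact lexLe_refl _

theorem golden_mem_VSeqs : golden M ∈ VSeqs M := by
  intro n
  rw [shift_golden]
  split_ifs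
  · exact ⟨reflSeq_golden_le, lexLe_refl _⟩
  · exact ⟨lexLe_refl _, reflSeq_golden_le⟩

theorem golden_mem_between {a : Seqs M} (h : LexLe (golden M) a) : golden M ∈ between a :=
  between_mono h golden_mem_VSeqs

theorem between_eq_empty_of_lt_golden {a : Seqs M} (h : LexLt a (golden M)) : between a = ∅ := by
  rw [Set.eq_empty_iff_forall_notMem]
  intro c hc
  have key : LexLe (golden M) a := by
    rcases eq_golden_or_of_mem_between_golden (between_mono h.le hc) with rfl | rfl
    · simpa using (hc 0).2
    · simpa [shift_reflSeq, shift_one_golden] using (hc 1).2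
  exact not_lexLe.2 h key

/-- Apart from `golden M`, all elements of `VSeqs M` exceed `golden M` in one of the first two
digits. -/
theorem eq_golden_or_ltIn {a : Seqs M} (ha : a ∈ VSeqs M) :
    a = golden M ∨ LtIn 2 (golden M) a := by
  have h0 : (a 0).rev ≤ a 0 := (ha 0).1.zero_le
  have hg0 := val_golden_zero M
  have hg1 := val_golden_one M
  have h0' : golden M 0 ≤ a 0 := by
    rw [Fin.le_def, Fin.val_rev] at h0
    rw [Fin.le_def]
    omega
  rcases h0'.lt_or_eq with h | h
  · exact Or.inr (ltIn_of_zero_lt h two_pos)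
  rcases lt_or_ge (golden M 1) (a 1) with h1 | h1
  · refine Or.inr ⟨1, one_lt_two, fun j hj => ?_, h1⟩
    obtain rfl : j = 0 := by omega
    exact h
  have h1' : (a 0).rev ≤ a 1 := (ha 1).1.zero_le
  have h2 : LexLe a (golden M) := by
    by_contra hlt
    have hlt' := not_lexLe.1 hlt
    -- A first difference from `golden M` would give a shift of `a` above `a` or one below
    -- its reflection.
    obtain ⟨i, hi, hi'⟩ := hlt'
    have hrev : (a 1 : ℕ) = M / 2 := by
      rw [Fin.le_def, Fin.val_rev] at h1'
      rw [Fin.le_def] at h1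
      rw [Fin.ext_iff] at h
      omega
    rcases i with _ | i
    · exact hi'.ne h
    have e := hi i (by omega)
    change golden M i = a i at e
    change golden M (i + 1) < a (i + 1) at hi'
    rw [golden_succ, Fin.lt_def, Fin.val_rev] at hi'
    have hmax : a (i + 1) ≤ a 0 := (ha (i + 1)).2.zero_le
    rw [Fin.le_def] at hmax
    rw [Fin.ext_iff] at h
    by_cases hev : Even i
    · have e0 : a i = a 0 := by
        rw [← e]
        apply Fin.ext
        rw [← h]
        simp [golden, hev]
      have : a (i + 1) ≤ a 1 := (ha i).2.one_le e0
      rw [Fin.le_def] at this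
      rw [e, e0] at hi'
      omega
    · have : (golden M i : ℕ) = M / 2 := by simp [golden, hev, digit]; omega
      omega
  left
  rcases eq_golden_or_of_mem_between_golden (between_mono h2 ha) with h | h'
  · exact h
  · exact h2.antisymm (by
      have := (ha 1).2
      rwa [h', shift_reflSeq, shift_one_golden, reflSeq_reflSeq, ← h'] at this)

theorem golden_le {a : Seqs M} (ha : a ∈ VSeqs M) : LexLe (golden M) a := by
  rcases eq_golden_or_ltIn ha with rfl | h
  · exact lexLe_refl _
  · exact h.le

/-- The first digit exceeds its reflection: by at least two, or, if `M = 2k + 1`, possibly by one,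
and then `a` begins with `(k + 1)(k + 1)`. -/
theorem zero_of_ne_golden {a : Seqs M} (ha : a ∈ VSeqs M) (hne : a ≠ golden M) :
    (a 0 : ℕ) ≥ M - a 0 + 2 ∨ ((a 0 : ℕ) = M - a 0 + 1 ∧ a 1 = a 0) := by
  have h := (eq_golden_or_ltIn ha).resolve_left hne
  have hg0 := val_golden_zero M
  have hg1 := val_golden_one M
  have h10 : a 1 ≤ a 0 := (ha 1).2.zero_le
  rw [Fin.le_def] at h10
  rw [Fin.ext_iff]
  obtain ⟨i, hi, h1, h2⟩ := h
  have h3 := (a 0).is_lt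
  rw [Fin.lt_def] at h2
  interval_cases i
  · by_cases hh : (a 0 : ℕ) ≥ M - a 0 + 2
    · exact Or.inl hh
    omega
  · have := h1 0 one_pos
    rw [Fin.ext_iff] at this
    omega

/-! ### A criterion for transitivity -/

/-- The first `n` digits of `c` can be continued in `between a` in such a way that the sequence
ends with any prescribed element of `between a`. -/
def Good (a c : Seqs M) (n : ℕ) : Prop :=
  ∀ d ∈ between a, ∃ e ∈ between a, Agree n e c ∧ ∃ N ≥ n, shift N e = d

theorem good_zero (a c : Seqs M) : Good a c 0 :=
  fun d hd => ⟨d, hd, fun i hi => by omega, 0, le_rfl, shift_zero d⟩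

theorem Good.mono {a c : Seqs M} {m n : ℕ} (h : Good a c n) (hm : m ≤ n) : Good a c m := by
  intro d hd
  obtain ⟨e, he, hc, N, hN, h⟩ := h d hd
  exact ⟨e, he, hc.mono hm, N, by omega, h⟩

theorem Good.congr {a c c' : Seqs M} {n : ℕ} (h : Good a c n) (hc : Agree n c c') :
    Good a c' n := by
  intro d hd
  obtain ⟨e, he, he', h⟩ := h d hd
  exact ⟨e, he, fun i hi => (he' i hi).trans (hc i hi), h⟩

theorem Good.reflSeq {a c : Seqs M} {n : ℕ} (h : Good a c n) : Good a (reflSeq c) n := by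
  intro d hd
  obtain ⟨e, he, hc, N, hN, h⟩ := h _ (reflSeq_mem_between hd)
  refine ⟨_, reflSeq_mem_between he, hc.reflSeq, N, hN, ?_⟩
  rw [shift_reflSeq, h, reflSeq_reflSeq]

/-- Only the suffixes that are not yet known to lie strictly between the bounds matter. -/
theorem good_of_suffix {a y : Seqs M} {n s : ℕ} (hs : s ≤ n)
    (h : ∀ r < s, LtIn (n - r) (shift r y) a ∧ LtIn (n - r) (reflSeq a) (shift r y))
    (hg : Good a (shift s y) (n - s)) : Good a y n := by
  intro d hd
  obtain ⟨e, he, hc, N, hN, hd⟩ := hg d hd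
  have hag : Agree n (splice y s e) y := by
    intro i hi
    by_cases h : i < s
    · exact splice_agree y s e i h
    · have := hc (i - s) (by omega)
      simpa [splice, h, shift, show s + (i - s) = i by omega] using this
  refine ⟨splice y s e, fun r => ?_, hag, s + N, by omega, ?_⟩
  · by_cases hr : r < s
    · have hag' := (hag.shift (r := r)).symm
      exact ⟨((h r hr).2.congr (fun _ _ => rfl) hag').le,
        ((h r hr).1.congr hag' (fun _ _ => rfl)).le⟩
    · rw [shift_splice_of_le y e (not_lt.1 hr)]
      exact he _
  · rw [← shift_shift, shift_splice_self, hd]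

open Classical in
/-- The longest suffix of the first `n` digits of `c` that is a prefix of `a` or of `reflSeq a`
starts at position `s`. -/
theorem exists_longest_suffix (a c : Seqs M) (n m : ℕ) (hm : m ≤ n) :
    ∃ s, m ≤ s ∧ s ≤ n ∧ (Agree (n - s) (shift s c) a ∨ Agree (n - s) (shift s c) (reflSeq a)) ∧
      ∀ r, m ≤ r → r < s →
        ¬ Agree (n - r) (shift r c) a ∧ ¬ Agree (n - r) (shift r c) (reflSeq a) := by
  have hex : ∃ s, m ≤ s ∧
      (Agree (n - s) (shift s c) a ∨ Agree (n - s) (shift s c) (reflSeq a)) :=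
    ⟨n, hm, Or.inl fun i hi => by omega⟩
  refine ⟨Nat.find hex, (Nat.find_spec hex).1, Nat.find_min' hex ⟨hm, Or.inl fun i hi => by omega⟩,
    (Nat.find_spec hex).2, fun r hmr hr => ?_⟩
  have := Nat.find_min hex hr
  tauto

theorem good_of_forall_prefix {a c : Seqs M} (h : ∀ n, Good a a n) (hc : c ∈ between a) (n : ℕ) :
    Good a c n := by
  obtain ⟨s, -, hs, hor, hmin⟩ := exists_longest_suffix a c n 0 (by omega)
  refine good_of_suffix hs (fun r hr => ?_) ?_
  · obtain ⟨h1, h2⟩ := hmin r (by omega) hr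
    exact ⟨(hc r).2.ltIn_of_not_agree h1,
      (hc r).1.ltIn_of_not_agree fun h => h2 h.symm⟩
  · rcases hor with h1 | h1
    · exact (h _).congr h1.symm
    · exact (h _).reflSeq.congr h1.symm

theorem isTransitive_of_good {a : Seqs M} (ha : a ∈ between a)
    (h : ∀ c ∈ between a, ∀ n, Good a c n) : IsTransitive (between a) := by
  have key : ∀ c ∈ between a, ∀ m, ∀ d ∈ between a, ∀ l,
      ∃ u ∈ language (between a), pre c m ++ u ++ pre d l ∈ language (between a) := by
    intro c hc m d hd l
    obtain ⟨e, he, hec, N, hN, hed⟩ := h c hc m d hd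
    refine ⟨pre (shift m e) (N - m), Or.inr ⟨e, he, m, by simp⟩, Or.inr ⟨e, he, 0, ?_⟩⟩
    have e1 : pre c m = pre e m := pre_eq_pre_iff.2 hec.symm
    have e2 : pre e m ++ pre (shift m e) (N - m) = pre e N := by
      rw [← pre_add, show m + (N - m) = N by omega]
    rw [shift_zero, e1, e2, ← hed, ← pre_add]
    simp
  have lang : ∀ w ∈ language (between a), ∃ c ∈ between a, ∃ n, w = pre c n := by
    rintro w (rfl | ⟨c, hc, n, hn⟩)
    · exact ⟨a, ha, 0, by simp [pre]⟩
    · exact ⟨_, shift_mem_between hc n, _, hn.symm⟩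
  intro w hw v hv
  obtain ⟨c, hc, m, rfl⟩ := lang w hw
  obtain ⟨d, hd, l, rfl⟩ := lang v hv
  exact key c hc m d hd l

theorem isTransitive_between_golden : IsTransitive (between (golden M)) := by
  refine isTransitive_of_good golden_mem_VSeqs fun c hc n d hd => ⟨c, hc, fun _ _ => rfl, ?_⟩
  have key : ∀ c : Seqs M, c = golden M ∨ c = reflSeq (golden M) →
      ∀ d : Seqs M, d = golden M ∨ d = reflSeq (golden M) → c = d ∨ shift 1 c = d := by
    rintro c (rfl | rfl) d (rfl | rfl) <;> simp [shift_reflSeq, shift_one_golden]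
  rcases key _ (eq_golden_or_of_mem_between_golden (shift_mem_between hc n)) d
    (eq_golden_or_of_mem_between_golden hd) with h | h
  · exact ⟨n, le_rfl, h⟩
  · exact ⟨n + 1, by omega, by rw [← shift_shift, h]⟩

/-! ### Lowering the last digit of a prefix -/

/-- If no proper suffix of `a₀ ... aᵢ` is a prefix of the reflection of `a`, and if in the case
`i = 0` there is enough room, then `(a₀ ... aᵢ⁻)^∞` is in `VSeqs M`. -/
theorem lowered_mem_VSeqs {a : Seqs M} {i : ℕ} (ha : a ∈ VSeqs M)
    (hclean : ∀ s, 1 ≤ s → s ≤ i → ¬ Agree (i + 1 - s) (shift s a) (reflSeq a))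
    (h0 : (a 0).rev < a 0) (hi : i = 0 → (a 0).rev.val + 2 ≤ a 0) (hpos : 0 < a i) :
    lowered a i ∈ VSeqs M := by
  have hself := lowered_self a i
  have hlt : ∀ {r}, r < i → lowered a i r = a r := fun h => lowered_of_lt h
  have hpos' : 0 < (a i : ℕ) := hpos
  have upper : ∀ r, LexLe (shift r (lowered a i)) (lowered a i) := by
    intro r
    rw [shift_lowered]
    have hr : r % (i + 1) < i + 1 := Nat.mod_lt _ (by omega)
    generalize r % (i + 1) = r at hr
    rcases Nat.eq_zero_or_pos r with rfl | hr0
    · rw [shift_zero]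
      exact lexLe_refl _
    by_contra hc
    obtain ⟨j, hj1, hj2⟩ := not_lexLe.1 hc
    change ∀ l < j, lowered a i l = lowered a i (r + l) at hj1
    change lowered a i j < lowered a i (r + j) at hj2
    rcases lt_or_ge (r + j) i with hrj | hrj
    · refine (LtIn.not_le (n := j + 1) ⟨j, by omega, fun l hl => ?_, ?_⟩) (ha r).2
      · have := hj1 l hl
        rwa [hlt (by omega), hlt (by omega)] at this
      · rwa [hlt (by omega), hlt hrj] at hj2
    · have hjj : i - r ≤ j := by omega
      have hag : Agree (i - r) a (shift r a) := by
        intro l hl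
        have := hj1 l (by omega)
        rwa [hlt (by omega), hlt (by omega)] at this
      have hle := (ha r).2.shift hag.symm
      have h1 : a i ≤ a (i - r) := by
        have := hle.zero_le
        rwa [shift_shift, shift, shift, show r + (i - r) + 0 = i by omega, add_zero] at this
      have e : lowered a i (i - r) = a (i - r) := hlt (by omega)
      have h2 : lowered a i (i - r) ≤ lowered a i i := by
        rcases hjj.lt_or_eq with h | h
        · have := hj1 _ h
          rw [show r + (i - r) = i by omega] at this
          exact this.le
        · rw [← h, show r + (i - r) = i by omega] at hj2
          exact hj2.le
      rw [e, Fin.le_def, hself] at h2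
      rw [Fin.le_def] at h1
      omega
  -- Strong induction on the position of a violation of the lower bound.
  have lower : ∀ j r, (∀ l < j, (lowered a i l).rev = lowered a i (r + l)) →
      ¬ lowered a i (r + j) < (lowered a i j).rev := by
    intro j
    induction j using Nat.strong_induction_on with
    | _ j ih =>
      intro r hj1 hj2
      have hmod : ∀ l, lowered a i (r + l) = lowered a i (r % (i + 1) + l) := fun l =>
        congrFun (shift_lowered a i r) l
      simp only [hmod] at hj1 hj2
      have hr : r % (i + 1) < i + 1 := Nat.mod_lt _ (by omega)
      generalize r % (i + 1) = r at hr hj1 hj2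
      clear hmod
      rcases Nat.eq_zero_or_pos r with rfl | hr0
      · simp only [zero_add] at hj1 hj2
        have hz : (lowered a i 0).rev ≤ lowered a i 0 := by
          rcases Nat.eq_zero_or_pos i with rfl | hi0
          · have := hi rfl
            rw [Fin.val_rev] at this
            rw [Fin.le_def, Fin.val_rev, hself]
            omega
          · rw [hlt hi0]
            exact h0.le
        rcases Nat.eq_zero_or_pos j with rfl | hj0
        · exact absurd hz (not_le.2 hj2)
        · have := hj1 0 hj0
          rcases Nat.eq_zero_or_pos i with rfl | hi0
          · have e : lowered a 0 j = lowered a 0 0 := by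
              have := congrFun (shift_lowered a 0 j) 0
              simpa [shift, Nat.mod_one] using this
            rw [e] at hj2
            exact absurd hz (not_le.2 hj2)
          · rw [hlt hi0] at this
            exact h0.ne this
      · have hst : LtIn (i + 1 - r) (reflSeq a) (shift r a) :=
          (ha r).1.ltIn_of_not_agree fun h => hclean r hr0 (by omega) h.symm
        obtain ⟨p, hp, hp1, hp2⟩ := hst
        change ∀ l < p, (a l).rev = a (r + l) at hp1
        change (a p).rev < a (r + p) at hp2
        -- Before position `i - r` there is nothing but `a` involved.
        rcases lt_or_ge p (i - r) with hpi | hpi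
        · have hjp : ¬ j < p := by
            intro h
            have := hp1 j h
            rw [hlt (by omega), hlt (by omega), this] at hj2
            exact lt_irrefl _ hj2
          rcases (not_lt.1 hjp).lt_or_eq with h | h
          · have := hj1 p h
            rw [hlt (by omega), hlt (by omega)] at this
            exact hp2.ne this
          · subst h
            rw [hlt (by omega), hlt (by omega)] at hj2
            exact lt_asymm hj2 hp2
        · obtain rfl : p = i - r := by omega
          rw [show r + (i - r) = i by omega] at hp2
          have hp3 : (lowered a i (i - r)).rev ≤ lowered a i i := by
            rw [hlt (by omega)]
            rw [Fin.lt_def] at hp2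
            rw [Fin.le_def, hself]
            omega
          rcases lt_trichotomy j (i - r) with h | h | h
          · have := hp1 j h
            rw [hlt (by omega), hlt (by omega), this] at hj2
            exact lt_irrefl _ hj2
          · rw [h, show r + (i - r) = i by omega] at hj2
            exact absurd hp3 (not_le.2 hj2)
          · -- The comparison is passed on to a later shift, with an earlier difference.
            have hper : ∀ l, lowered a i (r + (i + 1 - r + l)) = lowered a i l := by
              intro l
              have := congrFun (shift_lowered_self a i) l
              rw [shift] at this
              rwa [show r + (i + 1 - r + l) = i + 1 + l by omega]
            refine ih (j - (i + 1 - r)) (by omega) (i + 1 - r) (fun l hl => ?_) ?_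
            · have := hj1 (i + 1 - r + l) (by omega)
              rw [hper] at this
              rw [← this, Fin.rev_rev]
            · have := hper (j - (i + 1 - r))
              rw [show i + 1 - r + (j - (i + 1 - r)) = j by omega] at this ⊢
              rw [this, ← Fin.rev_lt_rev, Fin.rev_rev] at hj2
              exact hj2
  intro r
  refine ⟨?_, upper r⟩
  by_contra hc
  obtain ⟨j, hj1, hj2⟩ := not_lexLe.1 hc
  exact lower j r (fun l hl => (hj1 l hl).symm) hj2

/-! ### Irreducible sequences give transitive subshifts -/

theorem lowered_ltIn {a : Seqs M} {i : ℕ} (hpos : 0 < a i) : LtIn (i + 1) (lowered a i) a := by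
  refine ⟨i, by omega, fun j hj => lowered_of_lt hj, ?_⟩
  have : 0 < (a i : ℕ) := hpos
  rw [Fin.lt_def, lowered_self]
  omega

/-- If `a₀ = k + 1` and `M = 2k + 1`, this digit can be followed by every element that begins with
a digit at most `k`, and `(k + 1)k` can be followed by all others. -/
theorem good_one_of_zero_eq {a : Seqs M} (h0 : (a 0 : ℕ) = M - a 0 + 1) (h1 : a 1 = a 0) :
    Good a a 1 := by
  intro d hd
  have hlt := (a 0).is_lt
  have h0' : (a 0).rev < a 0 := by
    rw [Fin.lt_def, Fin.val_rev]
    omega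
  have hmem : ∀ d ∈ between a, ∀ x : Seqs M, LtIn 2 x a → LtIn 2 (reflSeq a) x →
      splice x 1 d = x → shift 1 x = d → x ∈ between a := by
    intro d hd x h1 h2 _ h3 r
    rcases r with _ | r
    · rw [shift_zero]
      exact ⟨h2.le, h1.le⟩
    · rw [add_comm, ← shift_shift, h3]
      exact hd r
  have hcons : ∀ d ∈ between a, d 0 ≤ (a 0).rev → splice a 1 d ∈ between a := by
    intro d hd hd0
    have e0 : splice a 1 d 0 = a 0 := by simp [splice]
    have e1 : splice a 1 d 1 = d 0 := by simp [splice]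
    refine hmem d hd _ ⟨1, one_lt_two, fun j hj => ?_, ?_⟩ (ltIn_of_zero_lt ?_ two_pos)
      (splice_congr (splice_agree _ _ _) d) (shift_splice_self _ _ _)
    · obtain rfl : j = 0 := by omega
      exact e0
    · rw [e1, h1]
      exact hd0.trans_lt h0'
    · rw [e0]
      exact h0'
  rcases le_or_gt (d 0) (a 0).rev with h | h
  · exact ⟨_, hcons d hd h, splice_agree _ _ _, 1, le_rfl, shift_splice_self _ _ _⟩
  · have e0 : splice (reflSeq a) 1 d 0 = (a 0).rev := by simp [splice, reflSeq]
    have e1 : splice (reflSeq a) 1 d 1 = d 0 := by simp [splice]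
    have hd' : splice (reflSeq a) 1 d ∈ between a := by
      refine hmem d hd _ (ltIn_of_zero_lt ?_ two_pos) ⟨1, one_lt_two, fun j hj => ?_, ?_⟩
        (splice_congr (splice_agree _ _ _) d) (shift_splice_self _ _ _)
      · rw [e0]
        exact h0'
      · obtain rfl : j = 0 := by omega
        rw [e0]
        rfl
      · rw [e1, reflSeq, h1]
        exact h
    refine ⟨_, hcons _ hd' e0.le, splice_agree _ _ _, 2, by omega, ?_⟩
    rw [← shift_shift 1 1, shift_splice_self, shift_splice_self]

/-- The case that a proper suffix of `a₀ ... aₙ₋₁` is a prefix of the reflection of `a`. The longest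
such suffix starts at `s`, and irreducibility at `s` bounds the length for which it can be
continued: it follows `reflSeq a` for at most `s - 1` digits. So at most `s` digits of
`reflSeq a` put after `a₀ ... aₛ₋₁` give a word below `a`. -/
theorem IsIrreducibleSeq.good_of_agree {a : Seqs M} (ha : IsIrreducibleSeq a)
    (hne : a ≠ golden M) {n : ℕ} (ih : ∀ m < n, Good a a m)
    (hex : ∃ s, 1 ≤ s ∧ s < n ∧ Agree (n - s) (shift s a) (reflSeq a)) : Good a a n := by
  classical
  have hV : a ∈ VSeqs M := ha.1
  have hz := zero_of_ne_golden hV hne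
  have hlt0 := (a 0).is_lt
  have hrev0 : (a 0).rev < a 0 := by
    rw [Fin.lt_def, Fin.val_rev]
    omega
  obtain ⟨hs1, hsn, hag⟩ := Nat.find_spec hex
  have hmin : ∀ t, 1 ≤ t → t < Nat.find hex → ¬ Agree (n - t) (shift t a) (reflSeq a) := by
    intro t ht hts h
    exact Nat.find_min hex hts ⟨ht, by omega, h⟩
  generalize Nat.find hex = s at hs1 hsn hag hmin
  -- When the match starting at `t` ends, none of the later matches can be alive.
  have hclean : ∀ t, 1 ≤ t → t < s → ¬ Agree (s - t) (shift t a) (reflSeq a) := by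
    intro t ht hts hst
    obtain ⟨p, hp, hp1, hp2⟩ := (hV t).1.ltIn_of_not_agree fun h => hmin t ht hts h.symm
    change ∀ l < p, (a l).rev = a (t + l) at hp1
    change (a p).rev < a (t + p) at hp2
    have hps : s - t ≤ p := by
      by_contra h
      exact hp2.ne (hst p (by omega)).symm
    have hag' : ∀ l < n - s, a (s + l) = (a l).rev := hag
    refine (LtIn.not_le (n := p + 1) ⟨p - (s - t), by omega, fun l hl => ?_, ?_⟩) (hV (s - t)).2
    · have h1 := hp1 (s - t + l) (by omega)
      have h2 := hag' l (by omega)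
      rw [show t + (s - t + l) = s + l by omega, h2] at h1
      exact (Fin.rev_injective h1).symm
    · have h2 := hag' (p - (s - t)) (by omega)
      rw [show s + (p - (s - t)) = t + p by omega] at h2
      rw [h2, Fin.rev_lt_rev] at hp2
      rwa [shift, show s - t + (p - (s - t)) = p by omega]
  obtain ⟨i, rfl⟩ : ∃ i, s = i + 1 := ⟨s - 1, by omega⟩
  have hpos : 0 < a i := by
    rcases Nat.eq_zero_or_pos i with rfl | hi
    · exact lt_of_le_of_lt (Fin.zero_le _) hrev0
    · have h1 := hclean i hi (by omega)
      have h2 := (hV i).1.zero_le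
      have h3 : a i ≠ (a 0).rev := by
        intro h
        apply h1
        intro l hl
        obtain rfl : l = 0 := by omega
        exact h
      exact lt_of_le_of_lt (Fin.zero_le _) (lt_of_le_of_ne h2 (Ne.symm h3))
  have hlow : lowered a i ∈ VSeqs M := by
    refine lowered_mem_VSeqs hV (fun s hs hsi => hclean s hs (by omega)) hrev0 (fun hi => ?_) hpos
    subst hi
    rw [Fin.val_rev]
    rcases hz with h | ⟨h, h1⟩
    · omega
    · -- Here `a₁ = a₀` excludes that the match starts at `1`.
      have := hag 0 (by omega)
      change a 1 = (a 0).rev at this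
      rw [h1] at this
      exact absurd this.symm hrev0.ne
  have hirr := ha.splice_lt hpos hlow
  have hlowlt := lowered_ltIn hpos
  have hend : ∃ l, i + 1 ≤ l ∧ l < 2 * (i + 1) ∧ a l ≠ (a (l - (i + 1))).rev := by
    by_contra hcon
    push Not at hcon
    refine not_lexLe.2 hirr (LtIn.le (n := 2 * (i + 1)) ⟨2 * i + 1, by omega, fun j hj => ?_, ?_⟩)
    · by_cases hji : j < i + 1
      · simp [splice, hji]
      · rw [hcon j (by omega) (by omega)]
        simp only [splice, hji, if_false, reflSeq]
        rw [lowered_of_lt (by omega)]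
    · rw [hcon (2 * i + 1) (by omega) (by omega)]
      have e : 2 * i + 1 - (i + 1) = i := by omega
      simp only [splice, show ¬ 2 * i + 1 < i + 1 by omega, if_false, reflSeq, e]
      rw [Fin.rev_lt_rev, Fin.lt_def, lowered_self]
      have : 0 < (a i : ℕ) := hpos
      omega
  obtain ⟨hl1, hl2, hl3⟩ := Nat.find_spec hend
  have hlmin : ∀ j, i + 1 ≤ j → j < Nat.find hend → a j = (a (j - (i + 1))).rev := by
    intro j hj hjl
    by_contra h
    exact Nat.find_min hend hjl ⟨hj, by omega, h⟩
  generalize Nat.find hend = l at hl1 hl2 hl3 hlmin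
  have hnl : n ≤ l := by
    by_contra h
    apply hl3
    have := hag (l - (i + 1)) (by omega)
    rwa [shift, show i + 1 + (l - (i + 1)) = l by omega] at this
  set y := splice a (i + 1) (reflSeq a) with hy
  have hyag : Agree l y a := by
    intro j hj
    by_cases hji : j < i + 1
    · exact splice_agree _ _ _ j hji
    · rw [hlmin j (by omega) hj]
      simp [hy, splice, hji, reflSeq]
  have hyl : LtIn (l + 1) y a := by
    refine ⟨l, by omega, hyag, ?_⟩
    have h1 : y l = (a (l - (i + 1))).rev := by
      simp [hy, splice, show ¬ l < i + 1 by omega, reflSeq]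
    rw [h1]
    have h2 : LexLe (reflSeq a) (shift (i + 1) a) := (hV (i + 1)).1
    have h3 : Agree (l - (i + 1)) (reflSeq a) (shift (i + 1) a) := by
      intro j hj
      have := hlmin (i + 1 + j) (by omega) (by omega)
      rw [show i + 1 + j - (i + 1) = j by omega] at this
      exact this.symm
    have h4 := (h2.shift h3).zero_le
    rw [shift_shift, shift, shift, add_zero, show i + 1 + (l - (i + 1)) + 0 = l by omega] at h4
    exact lt_of_le_of_ne h4 (Ne.symm hl3)
  have hgood : Good a y (l + 1) := by
    refine good_of_suffix (s := i + 1) (by omega) (fun r hr => ⟨?_, ?_⟩) ?_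
    · exact (hyl.shift_of_agree hyag (by omega)).trans_le (hV r).2
    · rcases Nat.eq_zero_or_pos r with rfl | hr0
      · refine ltIn_of_zero_lt ?_ (by omega)
        rw [shift_zero, hyag 0 (by omega)]
        exact hrev0
      · have h1 := (hV r).1.ltIn_of_not_agree fun h => hmin r hr0 hr h.symm
        refine (h1.congr (fun _ _ => rfl) ?_).mono (by omega)
        exact ((hyag.mono hnl).shift (r := r)).symm
    · rw [hy, shift_splice_self]
      exact (ih _ (by omega)).reflSeq
  exact (hgood.mono (by omega)).congr (hyag.mono hnl)

/-- The case that no proper suffix of `a₀ ... aᵢ` is a prefix of the reflection of `a`. Then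
`a₀ ... aᵢ` can be followed by many copies of the reflection of `a₀ ... aᵢ⁻`, because irreducibility
keeps the result strictly below `a`. Afterwards only suffixes of length at most `i` matter. -/
theorem IsIrreducibleSeq.good_of_not_agree {a : Seqs M} (ha : IsIrreducibleSeq a)
    (hne : a ≠ golden M) {i : ℕ} (ih : ∀ m < i + 1, Good a a m)
    (hclean : ∀ s, 1 ≤ s → s ≤ i → ¬ Agree (i + 1 - s) (shift s a) (reflSeq a)) :
    Good a a (i + 1) := by
  classical
  have hV : a ∈ VSeqs M := ha.1
  have hz := zero_of_ne_golden hV hne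
  have hlt0 := (a 0).is_lt
  have hrev0 : (a 0).rev < a 0 := by
    rw [Fin.lt_def, Fin.val_rev]
    omega
  by_cases hspecial : i = 0 ∧ (a 0 : ℕ) = M - a 0 + 1 ∧ a 1 = a 0
  · obtain ⟨rfl, h0, h1⟩ := hspecial
    exact good_one_of_zero_eq h0 h1
  -- The hypothesis is inherited by suffixes that are prefixes of `a`.
  have hpos : ∀ j, (∀ s, 1 ≤ s → s ≤ j → ¬ Agree (j + 1 - s) (shift s a) (reflSeq a)) →
      0 < a j := by
    intro j hc
    rcases Nat.eq_zero_or_pos j with rfl | hj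
    · exact lt_of_le_of_lt (Fin.zero_le _) hrev0
    · refine lt_of_le_of_lt (Fin.zero_le _) (lt_of_le_of_ne (hV j).1.zero_le fun h => ?_)
      refine hc j hj le_rfl fun l hl => ?_
      obtain rfl : l = 0 := by omega
      exact h.symm
  have hbelow : ∀ j, (∀ s, 1 ≤ s → s ≤ j → ¬ Agree (j + 1 - s) (shift s a) (reflSeq a)) →
      ¬ (j = 0 ∧ (a 0 : ℕ) = M - a 0 + 1 ∧ a 1 = a 0) →
      lowered a j ∈ VSeqs M ∧ LexLt (splice a (j + 1) (reflSeq (lowered a j))) a := by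
    intro j hc hsp
    have hl : lowered a j ∈ VSeqs M := by
      refine lowered_mem_VSeqs hV hc hrev0 (fun hj => ?_) (hpos j hc)
      rw [Fin.val_rev]
      omega
    exact ⟨hl, ha.splice_lt (hpos j hc) hl⟩
  obtain ⟨hlow, hirr⟩ := hbelow i hclean hspecial
  have hlowlt := lowered_ltIn (hpos i hclean)
  have hsub : between (lowered a i) ⊆ between a := between_mono hlowlt.le
  set b := reflSeq (lowered a i) with hb
  have hbmem : b ∈ between (lowered a i) := reflSeq_mem_between hlow
  set y := splice a (i + 1) b with hy
  have hyag : Agree (i + 1) y a := splice_agree _ _ _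
  have hb_lt : ∀ {l}, l < i → b l = (a l).rev := by
    intro l hl
    rw [hb, reflSeq, lowered_of_lt hl]
  have hupper : ∀ r < i + 1, LexLt (shift r y) a := by
    intro r hr
    rcases Nat.eq_zero_or_pos r with rfl | hr0
    · rwa [shift_zero]
    have hyr : shift r y = splice (shift r a) (i + 1 - r) b := shift_splice_of_ge _ _ (by omega)
    by_cases hag : Agree (i + 1 - r) (shift r a) a
    swap
    · have h1 := (hV r).2.ltIn_of_not_agree hag
      rw [hyr]
      exact (h1.congr (splice_agree _ _ _).symm (fun _ _ => rfl)).lexLt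
    obtain ⟨j, hj⟩ : ∃ j, i + 1 - r = j + 1 := ⟨i - r, by omega⟩
    have hcj : ∀ s, 1 ≤ s → s ≤ j → ¬ Agree (j + 1 - s) (shift s a) (reflSeq a) := by
      intro s hs hsj h
      refine hclean (r + s) (by omega) (by omega) fun l hl => ?_
      have h1 := hag (s + l) (by omega)
      have h2 := h l (by omega)
      rw [← h2]
      simpa [shift, add_assoc] using h1
    rw [hyr, splice_congr hag, hj]
    by_cases hsp : j = 0 ∧ (a 0 : ℕ) = M - a 0 + 1 ∧ a 1 = a 0
    · obtain ⟨rfl, h0, h1⟩ := hsp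
      refine LtIn.lexLt (n := 2) ⟨1, one_lt_two, fun l hl => ?_, ?_⟩
      · obtain rfl : l = 0 := by omega
        simp [splice]
      · have : splice a (0 + 1) b 1 = b 0 := by simp [splice]
        rw [this, hb_lt (by omega), h1]
        exact hrev0
    · obtain ⟨-, hirr'⟩ := hbelow j hcj hsp
      refine LexLe.trans_lt (splice_lexLe (LtIn.le (n := j + 1) ?_)) hirr'
      refine ⟨j, by omega, fun l hl => ?_, ?_⟩
      · rw [hb_lt (by omega), reflSeq, lowered_of_lt hl]
      · rw [hb_lt (by omega), reflSeq, Fin.rev_lt_rev, Fin.lt_def, lowered_self]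
        have : 0 < (a j : ℕ) := hpos j hcj
        omega
  have hlower : ∀ r < i + 1, LexLt (reflSeq a) (shift r y) := by
    intro r hr
    rcases Nat.eq_zero_or_pos r with rfl | hr0
    · refine (ltIn_of_zero_lt (n := 1) ?_ one_pos).lexLt
      rw [shift_zero, hyag 0 (by omega)]
      exact hrev0
    · have h1 := (hV r).1.ltIn_of_not_agree fun h => hclean r hr0 (by omega) h.symm
      exact (h1.congr (fun _ _ => rfl) (hyag.shift (r := r)).symm).lexLt
  have hK : ∃ K, ∀ r < i + 1, LtIn K (shift r y) a ∧ LtIn K (reflSeq a) (shift r y) := by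
    choose! f hf using fun r hr => lexLt_iff_exists_ltIn.1 (hupper r hr)
    choose! g hg using fun r hr => lexLt_iff_exists_ltIn.1 (hlower r hr)
    refine ⟨∑ r ∈ Finset.range (i + 1), (f r + g r), fun r hr => ?_⟩
    have := Finset.single_le_sum (f := fun r => f r + g r) (fun _ _ => Nat.zero_le _)
      (Finset.mem_range.2 hr)
    exact ⟨(hf r hr).mono (by omega), (hg r hr).mono (by omega)⟩
  obtain ⟨K, hK⟩ := hK
  have htail : ∀ r, i + 1 ≤ r → shift r y ∈ between (lowered a i) := by
    intro r hr
    rw [hy, shift_splice_of_le _ _ hr]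
    exact shift_mem_between hbmem _
  have hgood : Good a y (i + 1 + K) := by
    obtain ⟨s, hs1, hs2, hor, hmin⟩ := exists_longest_suffix a y (i + 1 + K) (i + 1) (by omega)
    -- A match of length `i + 1` would contradict the bounds given by `lowered a i`.
    have hshort : i + 1 + K - s < i + 1 := by
      by_contra hcon
      have hmem := htail s hs1 0
      rw [shift_zero] at hmem
      rcases hor with h | h
      · exact (hmem.2.trans_ltIn hlowlt).not_agree (h.mono (by omega))
      · exact (hlowlt.reflSeq.trans_le hmem.1).not_agree (h.symm.mono (by omega))
    refine good_of_suffix hs2 (fun r hr => ?_) ?_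
    · rcases lt_or_ge r (i + 1) with h | h
      · exact ⟨(hK r h).1.mono (by omega), (hK r h).2.mono (by omega)⟩
      · obtain ⟨h1, h2⟩ := hmin r h hr
        have hmem := hsub (htail r h) 0
        rw [shift_zero] at hmem
        exact ⟨hmem.2.ltIn_of_not_agree h1, hmem.1.ltIn_of_not_agree fun h => h2 h.symm⟩
    · rcases hor with h | h
      · exact (ih _ hshort).congr h.symm
      · exact (ih _ hshort).reflSeq.congr h.symm
  exact (hgood.mono (by omega)).congr hyag

theorem IsIrreducibleSeq.isTransitive {a : Seqs M} (ha : IsIrreducibleSeq a) :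
    IsTransitive (between a) := by
  by_cases hne : a = golden M
  · rw [hne]
    exact isTransitive_between_golden
  have hgood : ∀ n, Good a a n := by
    intro n
    induction n using Nat.strong_induction_on with
    | _ n ih =>
      by_cases hex : ∃ s, 1 ≤ s ∧ s < n ∧ Agree (n - s) (shift s a) (reflSeq a)
      · exact ha.good_of_agree hne ih hex
      · push Not at hex
        rcases n with _ | i
        · exact good_zero a a
        · exact ha.good_of_not_agree hne ih fun s hs hsi => hex s hs (by omega)
  exact isTransitive_of_good ha.1 fun c hc n => good_of_forall_prefix hgood hc n

/-! ### The sequence of the transitive base -/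

theorem transitiveSeq_zero (hM : 1 ≤ M) : (transitiveSeq M 0 : ℕ) = M / 2 + 1 := by
  have : M / 2 + 1 ≤ M := by omega
  by_cases h : Even M <;> simp [transitiveSeq, h, append, digit, this]

theorem shift_one_transitiveSeq : shift 1 (transitiveSeq M) = golden M := by
  funext i
  by_cases h : Even M
  · obtain ⟨k, rfl⟩ := h
    have e : (k + k + 1) / 2 = (k + k) / 2 := by omega
    simp [shift, transitiveSeq, append, periodic, golden, e, Nat.mod_one]
  · by_cases hi : Even i
    · have e : i % 2 = 0 := Nat.even_iff.1 hi
      have e' : (M + 1) / 2 = M / 2 + 1 := by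
        have := Nat.odd_iff.1 (Nat.not_even_iff_odd.1 h)
        omega
      simp [shift, transitiveSeq, append, periodic, golden, h, hi, e, e']
    · have e : i % 2 = 1 := Nat.odd_iff.1 (Nat.not_even_iff_odd.1 hi)
      simp [shift, transitiveSeq, append, periodic, golden, h, hi, e]

theorem shift_transitiveSeq (n : ℕ) :
    shift (n + 1) (transitiveSeq M) = if Even n then golden M else reflSeq (golden M) := by
  rw [add_comm, ← shift_shift, shift_one_transitiveSeq, shift_golden]

theorem transitiveSeq_succ (n : ℕ) : transitiveSeq M (n + 1) = golden M n := by
  have := congrFun (shift_one_transitiveSeq (M := M)) n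
  rwa [shift, add_comm 1 n] at this

theorem lt_transitiveSeq {c : Seqs M} (hM : 1 ≤ M) (h0 : c 0 = golden M 0)
    (h1 : c 1 ≤ (golden M 0).rev) : LexLt c (transitiveSeq M) := by
  have g0 := val_golden_zero M
  have t0 := transitiveSeq_zero hM
  have t1 : transitiveSeq M 1 = golden M 0 := transitiveSeq_succ 0
  rw [Fin.le_def, Fin.val_rev] at h1
  rcases lt_or_ge (c 0) (transitiveSeq M 0) with h | h
  · exact (ltIn_of_zero_lt h one_pos).lexLt
  · rw [Fin.le_def] at h
    refine ⟨1, fun j hj => ?_, ?_⟩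
    · obtain rfl : j = 0 := Nat.lt_one_iff.1 hj
      apply Fin.ext
      change (c 0 : ℕ) = _
      rw [h0] at h ⊢
      change _ = (transitiveSeq M 0 : ℕ)
      omega
    · change c 1 < transitiveSeq M 1
      rw [h0] at h
      rw [t1, Fin.lt_def]
      omega

theorem reflSeq_transitiveSeq_lt {c : Seqs M} (hM : 1 ≤ M) (h0 : c 0 = golden M 0) :
    LexLt (reflSeq (transitiveSeq M)) c := by
  refine (ltIn_of_zero_lt (n := 1) ?_ one_pos).lexLt
  have g0 := val_golden_zero M
  have t0 := transitiveSeq_zero hM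
  rw [h0, reflSeq, Fin.lt_def, Fin.val_rev]
  omega

theorem lt_transitiveSeq_of_zero {c : Seqs M} (hM : 1 ≤ M) (h0 : c 0 = (golden M 0).rev) :
    LexLt c (transitiveSeq M) := by
  have := reflSeq_transitiveSeq_lt (c := reflSeq c) hM (by rw [reflSeq, h0, Fin.rev_rev])
  exact not_lexLe.1 fun h => not_lexLe.2 this h.reflSeq

theorem reflSeq_transitiveSeq_lt_of_zero {c : Seqs M} (hM : 1 ≤ M)
    (h0 : c 0 = (golden M 0).rev) (h1 : golden M 0 ≤ c 1) :
    LexLt (reflSeq (transitiveSeq M)) c := by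
  have := lt_transitiveSeq (c := reflSeq c) hM (by rw [reflSeq, h0, Fin.rev_rev])
    (by rwa [reflSeq, Fin.rev_le_rev])
  refine not_lexLe.1 fun h => not_lexLe.2 this ?_
  have := h.reflSeq
  rwa [reflSeq_reflSeq] at this

theorem transitiveSeq_mem_VSeqs (hM : 1 ≤ M) : transitiveSeq M ∈ VSeqs M := by
  intro n
  rcases n with _ | n
  · rw [shift_zero]
    refine ⟨(ltIn_of_zero_lt (n := 1) ?_ one_pos).le, lexLe_refl _⟩
    have t0 := transitiveSeq_zero hM
    rw [reflSeq, Fin.lt_def, Fin.val_rev]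
    omega
  · rw [shift_transitiveSeq]
    split_ifs
    · exact ⟨(reflSeq_transitiveSeq_lt hM rfl).le,
        (lt_transitiveSeq hM rfl (golden_succ 0).le).le⟩
    · refine ⟨(reflSeq_transitiveSeq_lt_of_zero hM rfl ?_).le, (lt_transitiveSeq_of_zero hM rfl).le⟩
      rw [reflSeq, golden_succ 0, Fin.rev_rev]

/-- After `h g₀ ... g₂ᵣ₋₁`, where `h` is the first digit of `transitiveSeq M` and `g = golden M`, a
sequence `d` may follow directly if it lies between the reflection of `g` and `g`. If it is
smaller, the digit `g₀` may be put in between, and if it is larger, the reflection of `h`. -/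
theorem good_transitiveSeq (hM : 1 ≤ M) (r : ℕ) :
    Good (transitiveSeq M) (transitiveSeq M) (2 * r + 1) := by
  intro d hd
  set a := transitiveSeq M with ha
  have g0 := val_golden_zero M
  have t0 : (a 0 : ℕ) = M / 2 + 1 := transitiveSeq_zero hM
  have ah : (reflSeq a) 0 ≤ (golden M 0).rev := by
    rw [reflSeq, Fin.rev_le_rev, Fin.le_def]
    omega
  have hodd : ∀ n, a (2 * n + 1) = golden M 0 := by
    intro n
    rw [ha, transitiveSeq_succ]
    simp [golden]
  have heven : ∀ n, a (2 * n + 2) = (golden M 0).rev := by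
    intro n
    rw [← golden_succ 0, ha, transitiveSeq_succ]
    simp [golden]
  have hrefl1 : shift 1 (reflSeq a) = reflSeq (golden M) := by
    rw [shift_reflSeq, ha, shift_one_transitiveSeq]
  -- It suffices to look at the shifts that begin before the tail.
  have mem : ∀ n, ∀ d ∈ between a,
      (∀ s < n, LexLe (reflSeq a) (shift s (splice a n d)) ∧ LexLe (shift s (splice a n d)) a) →
      splice a n d ∈ between a := by
    intro n d hd h s
    rcases lt_or_ge s n with hs | hs
    · exact h s hs
    · rw [shift_splice_of_le _ _ hs]
      exact hd _
  have inner : ∀ n (d : Seqs M) s, 1 ≤ s → s + 1 < n →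
      LexLe (reflSeq a) (shift s (splice a n d)) ∧ LexLe (shift s (splice a n d)) a := by
    intro n d s hs hsn
    have e0 : shift s (splice a n d) 0 = a s := splice_agree a n d s (by omega)
    have e1 : shift s (splice a n d) 1 = a (s + 1) := splice_agree a n d (s + 1) hsn
    rcases Nat.even_or_odd' s with ⟨m, rfl | rfl⟩
    · obtain ⟨m, rfl⟩ : ∃ m', m = m' + 1 := ⟨m - 1, by omega⟩
      rw [show 2 * (m + 1) = 2 * m + 2 by ring, heven] at e0
      rw [hodd] at e1
      exact ⟨(reflSeq_transitiveSeq_lt_of_zero hM e0 e1.ge).le, (lt_transitiveSeq_of_zero hM e0).le⟩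
    · rw [hodd] at e0
      rw [show 2 * m + 1 + 1 = 2 * m + 2 by ring, heven] at e1
      exact ⟨(reflSeq_transitiveSeq_lt hM e0).le, (lt_transitiveSeq hM e0 e1.le).le⟩
  have first : ∀ n (d : Seqs M), 0 < n → LexLe d (shift n a) →
      LexLe (reflSeq a) (shift 0 (splice a n d)) ∧ LexLe (shift 0 (splice a n d)) a := by
    intro n d hn hle
    rw [shift_zero]
    refine ⟨(ltIn_of_zero_lt (n := 1) ?_ one_pos).le, ?_⟩
    · rw [splice_agree a n d 0 hn, reflSeq, Fin.lt_def, Fin.val_rev]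
      omega
    · conv_rhs => rw [← splice_shift a n]
      exact splice_lexLe hle
  have last : ∀ n (d : Seqs M), 0 < n → shift n (splice a (n + 1) d) = splice (shift n a) 1 d := by
    intro n d _
    rw [shift_splice_of_ge _ _ (by omega), Nat.add_sub_cancel_left]
  have cons : ∀ x d : Seqs M, x 0 = (golden M 0).rev ∨ x 0 = (reflSeq a) 0 →
      LexLe (reflSeq (golden M)) d →
      LexLe (reflSeq a) (splice x 1 d) ∧ LexLe (splice x 1 d) a := by
    intro x d hx hle
    have e0 : splice x 1 d 0 = x 0 := by simp [splice]
    constructor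
    · have h1 : (reflSeq a) 0 ≤ x 0 := by
        rcases hx with h | h
        · rw [h]
          exact ah
        · exact h.ge
      rcases h1.lt_or_eq with h | h
      · exact (ltIn_of_zero_lt (n := 1) (by rwa [e0]) one_pos).le
      · refine lexLe_of_agree_of_shift (n := 1) (fun l hl => ?_) ?_
        · obtain rfl : l = 0 := by omega
          rw [e0, h]
        · rwa [hrefl1, shift_splice_self]
    · refine (ltIn_of_zero_lt (n := 1) ?_ one_pos).le
      rw [e0]
      have : (golden M 0).rev < a 0 := by
        rw [Fin.lt_def, Fin.val_rev]
        omega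
      rcases hx with h | h
      · rw [h]
        exact this
      · rw [h]
        exact ah.trans_lt this
  have hs1 : shift (2 * r + 1) a = golden M := by
    rw [ha, shift_transitiveSeq]
    simp
  have hs2 : shift (2 * r + 2) a = reflSeq (golden M) := by
    rw [ha, shift_transitiveSeq]
    simp
  rcases lexLe_total d (reflSeq (golden M)) with h | h
  · refine ⟨splice a (2 * r + 2) d, mem _ d hd fun s hs => ?_,
      (splice_agree _ _ _).mono (by omega), 2 * r + 2, by omega, shift_splice_self _ _ _⟩
    rcases Nat.eq_zero_or_pos s with rfl | hs0
    · exact first _ d (by omega) (by rwa [hs2])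
    rcases lt_or_ge (s + 1) (2 * r + 2) with hs' | hs'
    · exact inner _ d s hs0 hs'
    · obtain rfl : s = 2 * r + 1 := by omega
      rw [last _ _ (by omega)]
      have e0 : splice (shift (2 * r + 1) a) 1 d 0 = golden M 0 := by simp [splice, hs1]
      have e1 : splice (shift (2 * r + 1) a) 1 d 1 = d 0 := by simp [splice]
      exact ⟨(reflSeq_transitiveSeq_lt hM e0).le,
        (lt_transitiveSeq hM e0 (e1.trans_le h.zero_le)).le⟩
  rcases lexLe_total d (golden M) with h' | h'
  · refine ⟨splice a (2 * r + 1) d, mem _ d hd fun s hs => ?_,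
      splice_agree _ _ _, 2 * r + 1, le_rfl, shift_splice_self _ _ _⟩
    rcases Nat.eq_zero_or_pos s with rfl | hs0
    · exact first _ d (by omega) (by rwa [hs1])
    rcases lt_or_ge (s + 1) (2 * r + 1) with hs' | hs'
    · exact inner _ d s hs0 hs'
    · obtain ⟨m, rfl⟩ : ∃ m, r = m + 1 := ⟨r - 1, by omega⟩
      obtain rfl : s = 2 * (m + 1) := by omega
      rw [last _ _ (by omega)]
      exact cons _ d (Or.inl (heven m)) h
  · have hd' : LexLe (reflSeq a) (splice (reflSeq a) 1 d) ∧ LexLe (splice (reflSeq a) 1 d) a :=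
      cons _ d (Or.inr rfl) h
    have hmem : splice (reflSeq a) 1 d ∈ between a := by
      intro s
      rcases s with _ | s
      · rwa [shift_zero]
      · rw [shift_splice_of_le _ _ (by omega)]
        exact hd _
    refine ⟨splice a (2 * r + 1) (splice (reflSeq a) 1 d), mem _ _ hmem fun s hs => ?_,
      splice_agree _ _ _, 2 * r + 1 + 1, by omega, ?_⟩
    · rcases Nat.eq_zero_or_pos s with rfl | hs0
      · refine first _ _ (by omega) ?_
        rw [hs1]
        refine (ltIn_of_zero_lt (n := 1) ?_ one_pos).le
        simp only [splice, zero_lt_one, if_true, reflSeq]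
        rw [Fin.lt_def, Fin.val_rev]
        omega
      rcases lt_or_ge (s + 1) (2 * r + 1) with hs' | hs'
      · exact inner _ _ s hs0 hs'
      · obtain ⟨m, rfl⟩ : ∃ m, r = m + 1 := ⟨r - 1, by omega⟩
        obtain rfl : s = 2 * (m + 1) := by omega
        rw [last _ _ (by omega)]
        have e0 : shift (2 * (m + 1)) a 0 = (golden M 0).rev := heven m
        set x := splice (shift (2 * (m + 1)) a) 1 (splice (reflSeq a) 1 d) with hx
        have x0 : x 0 = (golden M 0).rev := by
          rw [← e0]
          simp [hx, splice]
        refine ⟨?_, (lt_transitiveSeq_of_zero hM x0).le⟩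
        rcases ah.lt_or_eq with hlt | heq
        · exact (ltIn_of_zero_lt (n := 1) (by rwa [x0]) one_pos).le
        · refine lexLe_of_agree_of_shift (n := 1) (fun l hl => ?_) ?_
          · obtain rfl : l = 0 := by omega
            rw [x0, heq]
          · rw [hrefl1, hx, shift_splice_self]
            refine lexLe_of_agree_of_shift (n := 1) (fun l hl => ?_) ?_
            · obtain rfl : l = 0 := by omega
              change (golden M 0).rev = _
              rw [← heq]
              simp [splice]
            · rwa [shift_splice_self, shift_reflSeq, shift_one_golden, reflSeq_reflSeq]
    · rw [← shift_shift, shift_splice_self, shift_splice_self]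

theorem isTransitive_between_transitiveSeq (hM : 1 ≤ M) :
    IsTransitive (between (transitiveSeq M)) :=
  isTransitive_of_good (transitiveSeq_mem_VSeqs hM) fun _ hc n =>
    good_of_forall_prefix (fun n => (good_transitiveSeq hM n).mono (by omega)) hc n

/-! ### Reducible sequences -/

/-- The properties that `LexLe` and `LtIn n` have in common and that suffice to follow a bound
through a sequence block by block. -/
structure IsComparison (R : Seqs M → Seqs M → Prop) : Prop where
  le : ∀ {c d}, R c d → LexLe c d
  trans_le : ∀ {c d e}, R c d → LexLe d e → R c e
  le_trans : ∀ {c d e}, LexLe c d → R d e → R c e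
  shift : ∀ {n c d}, R c d → Agree n c d → R (shift n c) (shift n d)
  reflSeq : ∀ {c d}, R c d → R (reflSeq d) (reflSeq c)

theorem isComparison_lexLe : IsComparison (LexLe (M := M)) where
  le h := h
  trans_le := LexLe.trans
  le_trans := LexLe.trans
  shift := LexLe.shift
  reflSeq := LexLe.reflSeq

theorem isComparison_ltIn (n : ℕ) : IsComparison (LtIn (M := M) n) where
  le := LtIn.le
  trans_le := LtIn.trans_le
  le_trans := LexLe.trans_ltIn
  shift h hn := (h.shift hn).mono (Nat.sub_le _ _)
  reflSeq := LtIn.reflSeq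

theorem agree_of_sandwich {n : ℕ} {l c u : Seqs M} (h1 : LexLe l c) (h2 : LexLe c u)
    (h : Agree n l u) : Agree n c u := by
  by_contra hc
  exact (h1.trans_ltIn (h2.ltIn_of_not_agree hc)).not_agree h

/-- An element of `between a` that is bounded by the reflection of `(a₀ ... aᵢ⁻)^∞` starts with the
reflection of `a₀ ... aᵢ⁻` or of `a₀ ... aᵢ`, since there is no room for other blocks. -/
theorem comparison_step {a : Seqs M} {i : ℕ} {R : Seqs M → Seqs M → Prop} (hR : IsComparison R)
    (hpos : 0 < a i) (ha : R a (splice a (i + 1) (reflSeq (lowered a i)))) {d : Seqs M}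
    (hd : d ∈ between a) (h : R d (reflSeq (lowered a i))) :
    R (shift (i + 1) d) (reflSeq (lowered a i)) ∨ R (lowered a i) (shift (i + 1) d) := by
  set b := lowered a i with hb
  have hlow : R (reflSeq (splice a (i + 1) (reflSeq b))) d := by
    refine hR.trans_le (hR.reflSeq ha) ?_
    have := (hd 0).1
    rwa [shift_zero] at this
  set l := reflSeq (splice a (i + 1) (reflSeq b)) with hl
  have l_of : ∀ j < i + 1, l j = (a j).rev := fun j hj => by simp [hl, reflSeq, splice, hj]
  have hlu : Agree i l (reflSeq b) := fun j hj => by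
    rw [l_of j (by omega), reflSeq, hb, lowered_of_lt hj]
  have hdu : Agree i d (reflSeq b) := agree_of_sandwich (hR.le hlow) (hR.le h) hlu
  have hld : Agree i l d := fun j hj => (hlu j hj).trans (hdu j hj).symm
  have h1 : l i ≤ d i := ((hR.le hlow).shift hld).zero_le
  have h2 : d i ≤ reflSeq b i := ((hR.le h).shift hdu).zero_le
  have hbi : (b i : ℕ) = a i - 1 := lowered_self a i
  have hpos' : 0 < (a i : ℕ) := hpos
  rw [l_of i (by omega), Fin.le_def, Fin.val_rev] at h1
  rw [reflSeq, Fin.le_def, Fin.val_rev, hbi] at h2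
  have hai := (a i).is_lt
  have extend : ∀ {x y : Seqs M}, Agree i x y → x i = y i → Agree (i + 1) x y := by
    intro x y hxy hi j hj
    rcases (Nat.lt_succ_iff.1 hj).lt_or_eq with h | rfl
    · exact hxy j h
    · exact hi
  rcases Nat.lt_or_ge ((a i).rev : ℕ) (d i) with hlt | hge
  · left
    have hag : Agree (i + 1) d (reflSeq b) := by
      refine extend hdu (Fin.ext ?_)
      rw [Fin.val_rev] at hlt
      rw [reflSeq, Fin.val_rev, hbi]
      omega
    have := hR.shift h hag
    rwa [shift_reflSeq, hb, shift_lowered_self, ← hb] at this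
  · right
    have hag : Agree (i + 1) l d := by
      refine extend hld (Fin.ext ?_)
      rw [Fin.val_rev] at hge
      rw [l_of i (by omega), Fin.val_rev]
      omega
    have := hR.shift hlow hag
    rwa [hl, shift_reflSeq, shift_splice_self, reflSeq_reflSeq] at this

theorem comparison_blocks {a c : Seqs M} {i : ℕ} {R : Seqs M → Seqs M → Prop}
    (hR : IsComparison R) (hpos : 0 < a i)
    (ha : R a (splice a (i + 1) (reflSeq (lowered a i)))) (hc : c ∈ between a)
    (hca : Agree (i + 1) c a) (n : ℕ) :
    R (shift ((n + 1) * (i + 1)) c) (reflSeq (lowered a i)) ∨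
      R (lowered a i) (shift ((n + 1) * (i + 1)) c) := by
  induction n with
  | zero =>
    left
    have h0 := (hc 0).2
    rw [shift_zero] at h0
    have h1 : R c (splice a (i + 1) (reflSeq (lowered a i))) := hR.le_trans h0 ha
    have h2 := hR.shift h1 fun j hj => (hca j hj).trans (splice_agree _ _ _ j hj).symm
    rw [shift_splice_self] at h2
    simpa using h2
  | succ n ih =>
    rw [show (n + 1 + 1) * (i + 1) = (n + 1) * (i + 1) + (i + 1) by ring, ← shift_shift]
    have hmem := shift_mem_between hc ((n + 1) * (i + 1))
    generalize shift ((n + 1) * (i + 1)) c = d at ih hmem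
    rcases ih with h | h
    · exact comparison_step hR hpos ha hmem h
    · rcases comparison_step hR hpos ha (reflSeq_mem_between hmem) (hR.reflSeq h) with h | h
      · right
        have := hR.reflSeq h
        rwa [shift_reflSeq, reflSeq_reflSeq, reflSeq_reflSeq] at this
      · left
        have := hR.reflSeq h
        rwa [shift_reflSeq, reflSeq_reflSeq] at this

/-- If long pieces of `golden M` violate both bounds, then they cannot occur after
`a₀ ... aᵢ`. -/
theorem not_isTransitive_of_comparison {a : Seqs M} {i N : ℕ} {R : Seqs M → Seqs M → Prop}
    (hR : IsComparison R) (haV : a ∈ VSeqs M) (hpos : 0 < a i)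
    (ha : R a (splice a (i + 1) (reflSeq (lowered a i))))
    (hN : ∀ r d, Agree N d (shift r (golden M)) → ¬ R (lowered a i) d) :
    ¬ IsTransitive (between a) := by
  intro hT
  obtain ⟨u, -, hu⟩ := hT (pre a (i + 1)) (Or.inr ⟨a, haV, 0, by simp⟩)
    (pre (golden M) (N + (i + 1)))
    (Or.inr ⟨golden M, golden_mem_between (golden_le haV), 0, by simp⟩)
  rcases hu with h | ⟨c, hc, k, hk⟩
  · have := congrArg List.length h
    simp at this
  have hmem := shift_mem_between hc k
  generalize shift k c = c at hk hmem
  rw [List.length_append, List.length_append, length_pre, length_pre, pre_add, pre_add] at hk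
  obtain ⟨h1, h2⟩ := List.append_inj hk (by simp)
  obtain ⟨h3, -⟩ := List.append_inj h1 (by simp)
  rw [pre_eq_pre_iff] at h2 h3
  -- The first multiple of the block length after the beginning of the piece of `golden M`.
  set p := i + 1 + u.length with hp
  have hdiv := Nat.div_add_mod p (i + 1)
  have hmod := Nat.mod_lt p (show 0 < i + 1 by omega)
  set n := p / (i + 1) with hn
  obtain ⟨r, hr⟩ : ∃ r, (n + 1) * (i + 1) = p + r := ⟨i + 1 - p % (i + 1), by
    have : (n + 1) * (i + 1) = (i + 1) * n + (i + 1) := by ring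
    omega⟩
  have hri : r ≤ i + 1 := by
    have : (n + 1) * (i + 1) = (i + 1) * n + (i + 1) := by ring
    omega
  have hag : Agree N (shift ((n + 1) * (i + 1)) c) (shift r (golden M)) := by
    rw [hr, ← shift_shift]
    exact (h2.shift (r := r)).mono (by omega)
  rcases comparison_blocks hR hpos ha hmem h3 n with h | h
  · have h := hR.reflSeq h
    rw [reflSeq_reflSeq] at h
    refine hN (1 + r) _ ?_ h
    rw [← shift_shift, shift_one_golden]
    exact hag.reflSeq
  · exact hN r _ hag h

/-- If `a₀ ... aᵢ⁻` is a period of `golden M`, then it is the shortest one. -/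
theorem splice_eq_transitiveSeq {a : Seqs M} {i : ℕ} (hM : 1 ≤ M) (ha : a ∈ VSeqs M)
    (hpos : 0 < a i) (h : lowered a i = golden M) :
    splice a (i + 1) (reflSeq (lowered a i)) = transitiveSeq M := by
  have hpos' : 0 < (a i : ℕ) := hpos
  have g0 := val_golden_zero M
  have g1 := val_golden_one M
  have t0 := transitiveSeq_zero hM
  have hself := lowered_self a i
  have hlt : ∀ {r}, r < i → golden M r = a r := fun hr => by rw [← h, lowered_of_lt hr]
  rw [h] at hself ⊢
  rcases Nat.even_or_odd M with hev | hodd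
  · obtain ⟨k, hk⟩ := hev
    have hconst : ∀ n, (golden M n : ℕ) = k := by
      intro n
      by_cases hn : Even n <;> simp [golden, digit, hn] <;> omega
    rw [hconst] at hself
    have hi : i = 0 := by
      by_contra hi
      have h1 := (ha i).2.zero_le
      change a i ≤ a 0 at h1
      rw [← hlt (Nat.pos_of_ne_zero hi), Fin.le_def, hconst] at h1
      omega
    subst hi
    funext n
    apply Fin.ext
    rcases n with _ | n
    · rw [splice_agree _ _ _ 0 (by omega)]
      omega
    · rw [transitiveSeq_succ]
      simp only [splice, show ¬ n + 1 < 0 + 1 by omega, if_false, reflSeq, Fin.val_rev, hconst]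
      omega
  · have hg : ∀ n, (golden M n : ℕ) = if Even n then M / 2 + 1 else M / 2 := by
      intro n
      have := Nat.odd_iff.1 hodd
      by_cases hn : Even n <;> simp [golden, digit, hn] <;> omega
    have hper : golden M (i + 1) = golden M 0 := by
      have h1 := shift_lowered_self a i
      rw [h] at h1
      exact congrFun h1 0
    have hiodd : ¬ Even i := by
      intro hi
      rw [Fin.ext_iff, hg, hg] at hper
      simp [Nat.even_add_one, hi] at hper
    have hai : (a i : ℕ) = M / 2 + 1 := by
      rw [hg, if_neg hiodd] at hself
      omega
    obtain ⟨m, rfl⟩ : ∃ m, i = m + 1 := ⟨i - 1, by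
      rcases i with _ | i
      · simp at hiodd
      · rfl⟩
    have hm : Even m := by
      rw [Nat.even_add_one] at hiodd
      exact not_not.1 hiodd
    have hm0 : m = 0 := by
      by_contra hm0
      have hm2 : 1 < m := by
        rcases m with _ | _ | m
        · exact absurd rfl hm0
        · simp at hm
        · omega
      have h0 : shift m a 0 = a 0 := by
        change a m = a 0
        rw [← hlt (by omega), ← hlt (by omega)]
        apply Fin.ext
        rw [hg, hg]
        simp [hm]
      have h1 := (ha m).2.one_le h0
      change a (m + 1) ≤ a 1 at h1
      rw [← hlt (by omega : 1 < m + 1), Fin.le_def, hg] at h1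
      simp at h1
      omega
    subst hm0
    funext n
    rcases n with _ | _ | n
    · apply Fin.ext
      rw [splice_agree _ _ _ 0 (by omega), ← hlt (by omega), hg, t0]
      simp
    · apply Fin.ext
      rw [splice_agree _ _ _ _ (by omega), transitiveSeq_succ, hg, hai]
      simp
    · rw [transitiveSeq_succ, golden_succ]
      simp [splice, reflSeq]

theorem isTransitive_iff {a : Seqs M} (hM : 1 ≤ M) (ha : a ∈ VSeqs M) :
    IsTransitive (between a) ↔ IsIrreducibleSeq a ∨ a = transitiveSeq M := by
  constructor
  swap
  · rintro (h | rfl)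
    · exact h.isTransitive
    · exact isTransitive_between_transitiveSeq hM
  intro hT
  by_contra hcon
  push Not at hcon
  obtain ⟨hirr, hne⟩ := hcon
  have hex : ∃ i, 0 < a i ∧ lowered a i ∈ VSeqs M ∧
      LexLe a (splice a (i + 1) (reflSeq (lowered a i))) := by
    by_contra hno
    push Not at hno
    refine hirr ⟨ha, fun i hi hv => ?_⟩
    rw [append_pre, periodic_wordPlus_eq hi]
    exact not_lexLe.1 (hno i hi hv)
  obtain ⟨i, hpos, hv, hle⟩ := hex
  have hgr : ∀ r, LexLe (shift r (golden M)) (golden M) := fun r => (golden_mem_VSeqs r).2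
  rcases eq_golden_or_ltIn hv with hg | hg
  · have hlt := hle.lt_of_ne (by rwa [splice_eq_transitiveSeq hM ha hpos hg])
    obtain ⟨L, hL⟩ := lexLt_iff_exists_ltIn.1 hlt
    refine not_isTransitive_of_comparison (N := L) (isComparison_ltIn L) ha hpos hL
      (fun r d hd h => ?_) hT
    rw [hg] at h
    exact (h.congr (fun _ _ => rfl) hd).not_le (hgr r)
  · refine not_isTransitive_of_comparison (N := 2) isComparison_lexLe ha hpos hle
      (fun r d hd h => ?_) hT
    exact (((hgr r).trans_ltIn hg).congr hd.symm (fun _ _ => rfl)).not_le h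

/-! ### Values of sequences in a base -/

/-- The number with expansion `c` in base `q`. -/
noncomputable def value (q : ℝ) (c : Seqs M) : ℝ := ∑' i : ℕ, ((c i : ℕ) : ℝ) / q ^ (i + 1)

theorem val_le (c : Seqs M) (i : ℕ) : ((c i : ℕ) : ℝ) ≤ M := by
  have := (c i).is_lt
  exact_mod_cast (by omega : (c i : ℕ) ≤ M)

theorem hasSum_const_div {q : ℝ} (hq : 1 < q) (x : ℝ) :
    HasSum (fun i : ℕ => x / q ^ (i + 1)) (x / (q - 1)) := by
  have h := (hasSum_geometric_of_lt_one (inv_nonneg.2 (by linarith : 0 ≤ q))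
    (inv_lt_one_of_one_lt₀ hq)).mul_left (x / q)
  have hq0 : q ≠ 0 := by linarith
  have hq1 : q - 1 ≠ 0 := by linarith
  have e1 : (fun i : ℕ => x / q ^ (i + 1)) = fun i : ℕ => x / q * q⁻¹ ^ i := by
    funext i
    rw [inv_pow, pow_succ]
    field_simp
  have e2 : x / (q - 1) = x / q * (1 - q⁻¹)⁻¹ := by
    rw [show 1 - q⁻¹ = (q - 1) / q by field_simp]
    field_simp
  rw [e1, e2]
  exact h

theorem summable_digits {q : ℝ} (hq : 1 < q) (c : Seqs M) :
    Summable (fun i : ℕ => ((c i : ℕ) : ℝ) / q ^ (i + 1)) := by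
  have hq0 : 0 < q := by linarith
  refine Summable.of_nonneg_of_le (fun i => by positivity) (fun i => ?_)
    (hasSum_const_div hq (M : ℝ)).summable
  have := val_le c i
  gcongr

theorem isExpansion_iff {q x : ℝ} (hq : 1 < q) {c : Seqs M} :
    IsExpansion M q x c ↔ value q c = x :=
  (summable_digits hq c).hasSum_iff

theorem value_nonneg {q : ℝ} (hq : 1 < q) (c : Seqs M) : 0 ≤ value q c :=
  tsum_nonneg fun i => by
    have hq0 : 0 < q := by linarith
    positivity

theorem value_le {q : ℝ} (hq : 1 < q) (c : Seqs M) : value q c ≤ M / (q - 1) := by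
  rw [← (hasSum_const_div hq (M : ℝ)).tsum_eq]
  refine (summable_digits hq c).tsum_le_tsum (fun i => ?_) (hasSum_const_div hq (M : ℝ)).summable
  have hq0 : 0 < q := by linarith
  have := val_le c i
  gcongr

theorem value_eq_sum_add {q : ℝ} (hq : 1 < q) (c : Seqs M) (n : ℕ) :
    value q c = ∑ i ∈ Finset.range n, ((c i : ℕ) : ℝ) / q ^ (i + 1) +
      value q (shift n c) / q ^ n := by
  rw [value, ← (summable_digits hq c).sum_add_tsum_nat_add n, value, ← tsum_div_const]
  congr 2
  funext i
  have hq0 : q ≠ 0 := by linarith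
  rw [shift, add_comm n i, div_div, ← pow_add]
  congr 2
  ring

theorem value_eq_zero_add {q : ℝ} (hq : 1 < q) (c : Seqs M) :
    q * value q c = (c 0 : ℕ) + value q (shift 1 c) := by
  rw [value_eq_sum_add hq c 1]
  have hq0 : q ≠ 0 := by linarith
  simp
  field_simp

theorem value_pos {q : ℝ} (hq : 1 < q) {c : Seqs M} (hc : ∃ n, c n ≠ 0) : 0 < value q c := by
  obtain ⟨n, hn⟩ := hc
  have hq0 : 0 < q := by linarith
  refine (summable_digits hq c).tsum_pos (fun i => by positivity) n ?_
  have : 0 < (c n : ℕ) := Nat.pos_of_ne_zero fun h => hn (Fin.ext h)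
  positivity

theorem IsInfinite.shift {c : Seqs M} (hc : IsInfinite c) (n : ℕ) :
    IsInfinite (shift n c) := by
  intro N
  obtain ⟨m, hm, h⟩ := hc (n + N)
  exact ⟨m - n, by omega, by rwa [UniqueExpansion.shift, show n + (m - n) = m by omega]⟩

theorem sum_lt_one {q : ℝ} (hq : 1 < q) {c : Seqs M} (hc : IsInfinite c) (h : value q c = 1)
    (n : ℕ) : ∑ i ∈ Finset.range n, ((c i : ℕ) : ℝ) / q ^ (i + 1) < 1 := by
  have h1 := value_eq_sum_add hq c n
  obtain ⟨m, -, hm⟩ := hc.shift n 0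
  have h2 := value_pos hq ⟨m, hm⟩
  have : 0 < value q (shift n c) / q ^ n := div_pos h2 (pow_pos (by linarith) n)
  linarith

/-! ### The quasi-greedy algorithm -/

/-- The largest digit that is smaller than `y`. -/
noncomputable def digitBelow (M : ℕ) (y : ℝ) : Fin (M + 1) := digit M (⌈y⌉₊ - 1)

theorem digitBelow_lt {y : ℝ} (hy : 0 < y) : ((digitBelow M y : ℕ) : ℝ) < y := by
  have h1 : 0 < ⌈y⌉₊ := Nat.ceil_pos.2 hy
  have h2 : ((⌈y⌉₊ - 1 : ℕ) : ℝ) < y := Nat.lt_ceil.1 (by omega)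
  refine lt_of_le_of_lt ?_ h2
  exact_mod_cast Nat.min_le_left _ _

theorem le_digitBelow {y : ℝ} {d : Fin (M + 1)} (h : ((d : ℕ) : ℝ) < y) : d ≤ digitBelow M y := by
  have h1 := Nat.lt_ceil.2 h
  have h2 := d.is_lt
  rw [Fin.le_def]
  simp only [digitBelow, digit]
  omega

theorem le_digitBelow_add_one {y : ℝ} (h : (digitBelow M y : ℕ) ≠ M) :
    y ≤ (digitBelow M y : ℕ) + 1 := by
  have h2 : ⌈y⌉₊ ≤ (digitBelow M y : ℕ) + 1 := by
    simp only [digitBelow, digit] at h ⊢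
    omega
  exact_mod_cast Nat.ceil_le.1 h2

/-- The remainders of the quasi-greedy algorithm, scaled by the powers of the base. -/
noncomputable def remainder (M : ℕ) (q : ℝ) : ℕ → ℝ
  | 0 => 1
  | n + 1 => q * remainder M q n - (digitBelow M (q * remainder M q n) : ℕ)

/-- The digits of the quasi-greedy algorithm. -/
noncomputable def quasiGreedy (M : ℕ) (q : ℝ) : Seqs M :=
  fun n => digitBelow M (q * remainder M q n)

theorem remainder_pos {q : ℝ} (hq : 1 < q) (n : ℕ) : 0 < remainder M q n := by
  induction n with
  | zero => exact one_pos
  | succ n ih =>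
    rw [remainder, sub_pos]
    exact digitBelow_lt (mul_pos (by linarith) ih)

theorem remainder_le {q : ℝ} (hq : 1 < q) (hq' : q ≤ M + 1) (n : ℕ) :
    remainder M q n ≤ M / (q - 1) := by
  have h1 : (1 : ℝ) ≤ M / (q - 1) := by
    rw [le_div_iff₀ (by linarith)]
    linarith
  induction n with
  | zero => exact h1
  | succ n ih =>
    rw [remainder]
    by_cases h : (digitBelow M (q * remainder M q n) : ℕ) = M
    · rw [h]
      have h2 : q * remainder M q n ≤ q * (M / (q - 1)) :=
        mul_le_mul_of_nonneg_left ih (by linarith)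
      have h3 : q * (M / (q - 1)) - M = M / (q - 1) := by
        have : q - 1 ≠ 0 := by linarith
        field_simp
        ring
      linarith
    · have := le_digitBelow_add_one h
      linarith

theorem sum_quasiGreedy {q : ℝ} (hq : 1 < q) (n : ℕ) :
    ∑ i ∈ Finset.range n, ((quasiGreedy M q i : ℕ) : ℝ) / q ^ (i + 1) =
      1 - remainder M q n / q ^ n := by
  have hq0 : q ≠ 0 := by linarith
  induction n with
  | zero => simp [remainder]
  | succ n ih =>
    rw [Finset.sum_range_succ, ih, remainder, quasiGreedy]
    field_simp
    ring

theorem sum_quasiGreedy_lt_one {q : ℝ} (hq : 1 < q) (n : ℕ) :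
    ∑ i ∈ Finset.range n, ((quasiGreedy M q i : ℕ) : ℝ) / q ^ (i + 1) < 1 := by
  rw [sum_quasiGreedy hq]
  have := div_pos (remainder_pos (M := M) hq n) (pow_pos (by linarith : 0 < q) n)
  linarith

theorem value_quasiGreedy {q : ℝ} (hq : 1 < q) (hq' : q ≤ M + 1) :
    value q (quasiGreedy M q) = 1 := by
  have hq0 : 0 < q := by linarith
  have hlim : Filter.Tendsto (fun n => remainder M q n / q ^ n) Filter.atTop (nhds 0) := by
    refine squeeze_zero (fun n => (div_pos (remainder_pos hq n) (pow_pos hq0 n)).le)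
      (fun n => div_le_div_of_nonneg_right (remainder_le hq hq' n) (pow_pos hq0 n).le) ?_
    exact tendsto_const_nhds.div_atTop (tendsto_pow_atTop_atTop_of_one_lt hq)
  refine HasSum.tsum_eq ?_
  rw [hasSum_iff_tendsto_nat_of_nonneg (fun i => by positivity)]
  simp only [sum_quasiGreedy hq]
  simpa using hlim.const_sub 1

theorem isInfinite_quasiGreedy {q : ℝ} (hq : 1 < q) (hq' : q ≤ M + 1) :
    IsInfinite (quasiGreedy M q) := by
  intro N
  by_contra hcon
  push Not at hcon
  have h1 := value_eq_sum_add hq (quasiGreedy M q) N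
  have h2 : value q (shift N (quasiGreedy M q)) = 0 := by
    rw [value]
    convert tsum_zero with i
    rw [shift, hcon (N + i) (by omega)]
    simp
  have h3 := sum_quasiGreedy_lt_one (M := M) hq N
  rw [value_quasiGreedy hq hq', h2] at h1
  simp at h1
  linarith

theorem le_quasiGreedy {q : ℝ} (hq : 1 < q) {d : Seqs M}
    (h : ∀ n, ∑ i ∈ Finset.range n, ((d i : ℕ) : ℝ) / q ^ (i + 1) < 1) :
    LexLe d (quasiGreedy M q) := by
  by_contra hcon
  obtain ⟨n, h1, h2⟩ := not_lexLe.1 hcon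
  change ∀ j < n, quasiGreedy M q j = d j at h1
  change quasiGreedy M q n < d n at h2
  refine not_le.2 h2 (le_digitBelow ?_)
  have h3 := h (n + 1)
  have hsum : ∑ i ∈ Finset.range n, ((d i : ℕ) : ℝ) / q ^ (i + 1) =
      ∑ i ∈ Finset.range n, ((quasiGreedy M q i : ℕ) : ℝ) / q ^ (i + 1) :=
    Finset.sum_congr rfl fun i hi => by rw [h1 i (Finset.mem_range.1 hi)]
  rw [Finset.sum_range_succ, hsum, sum_quasiGreedy hq] at h3
  have hq0 : 0 < q := by linarith
  have h4 : ((d n : ℕ) : ℝ) / q ^ (n + 1) < remainder M q n / q ^ n := by linarith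
  rwa [div_lt_div_iff₀ (pow_pos hq0 _) (pow_pos hq0 _), pow_succ, mul_comm (q ^ n) q, ← mul_assoc,
    mul_lt_mul_iff_left₀ (pow_pos hq0 _), mul_comm] at h4

theorem isQuasiGreedy_quasiGreedy {q : ℝ} (hq : q ∈ Ioc (1 : ℝ) (M + 1)) :
    IsQuasiGreedy M q (quasiGreedy M q) :=
  ⟨(isExpansion_iff hq.1).2 (value_quasiGreedy hq.1 hq.2), isInfinite_quasiGreedy hq.1 hq.2,
    fun _ hd hi => le_quasiGreedy hq.1 (sum_lt_one hq.1 hi ((isExpansion_iff hq.1).1 hd))⟩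

theorem alpha_eq {q : ℝ} (hq : q ∈ Ioc (1 : ℝ) (M + 1)) : alpha M q = quasiGreedy M q := by
  have hex : ∃ c : Seqs M, IsQuasiGreedy M q c := ⟨_, isQuasiGreedy_quasiGreedy hq⟩
  have h1 := isQuasiGreedy_quasiGreedy hq
  have h2 : IsQuasiGreedy M q (alpha M q) := by
    rw [alpha, dif_pos hex]
    exact hex.choose_spec
  exact (h1.2.2 _ h2.1 h2.2.1).antisymm (h2.2.2 _ h1.1 h1.2.1)

theorem value_lt_value {q q' : ℝ} (hq : 1 < q) (h : q < q') {c : Seqs M} (hc : ∃ n, c n ≠ 0) :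
    value q' c < value q c := by
  obtain ⟨n, hn⟩ := hc
  have hq0 : 0 < q := by linarith
  refine Summable.tsum_lt_tsum (i := n) (fun i => ?_) ?_ (summable_digits (hq.trans h) c)
    (summable_digits hq c)
  · gcongr
  · have : 0 < (c n : ℕ) := Nat.pos_of_ne_zero fun h => hn (Fin.ext h)
    gcongr

theorem alpha_lt_alpha {q q' : ℝ} (hq : q ∈ Ioc (1 : ℝ) (M + 1)) (hq' : q' ∈ Ioc (1 : ℝ) (M + 1))
    (h : q < q') : LexLt (alpha M q) (alpha M q') := by
  rw [alpha_eq hq, alpha_eq hq']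
  have hq0 : 0 < q := by linarith [hq.1]
  refine LexLe.lt_of_ne (le_quasiGreedy hq'.1 fun n => ?_) fun he => ?_
  · refine lt_of_le_of_lt (Finset.sum_le_sum fun i _ => ?_) (sum_quasiGreedy_lt_one (M := M) hq.1 n)
    gcongr
  · obtain ⟨n, -, hn⟩ := isInfinite_quasiGreedy hq.1 hq.2 0
    have := value_lt_value hq.1 h ⟨n, hn⟩
    rw [value_quasiGreedy hq.1 hq.2, he, value_quasiGreedy hq'.1 hq'.2] at this
    exact lt_irrefl _ this

theorem alpha_le_alpha_iff {q q' : ℝ} (hq : q ∈ Ioc (1 : ℝ) (M + 1))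
    (hq' : q' ∈ Ioc (1 : ℝ) (M + 1)) : LexLe (alpha M q) (alpha M q') ↔ q ≤ q' := by
  constructor
  · intro h
    by_contra hlt
    exact not_lexLe.2 (alpha_lt_alpha hq' hq (not_le.1 hlt)) h
  · intro h
    rcases h.eq_or_lt with rfl | h
    · exact lexLe_refl _
    · exact (alpha_lt_alpha hq hq' h).le

/-- The tails of an expansion of `1` that is its own largest tail represent numbers at most `1`. -/
theorem value_shift_le_one {q : ℝ} (hq : 1 < q) {c : Seqs M} (hc : IsInfinite c)
    (hmax : ∀ n, LexLe (shift n c) c) (h1 : value q c = 1) (n : ℕ) : value q (shift n c) ≤ 1 := by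
  have hq0 : 0 < q := by linarith
  -- At the first difference from `c` one digit is lost, and the rest is a tail again; so the excess
  -- over `1` shrinks by the factor `q` each time.
  have step : ∀ (C : ℝ), 0 ≤ C → (∀ n, value q (shift n c) - 1 ≤ C) →
      ∀ n, value q (shift n c) - 1 ≤ C / q := by
    intro C hC hbound n
    rcases (hmax n).eq_or_lt with h | ⟨m, hm1, hm2⟩
    · rw [h, h1, sub_self]
      positivity
    change ∀ j < m, shift n c j = c j at hm1
    change shift n c m < c m at hm2
    have e1 := value_eq_sum_add hq (shift n c) (m + 1)
    have e2 := sum_lt_one hq hc h1 (m + 1)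
    rw [Finset.sum_range_succ] at e1 e2
    rw [Finset.sum_congr rfl fun i hi => by rw [hm1 i (Finset.mem_range.1 hi)], shift_shift] at e1
    have e3 := hbound (n + (m + 1))
    have e4 : ((shift n c m : ℕ) : ℝ) + 1 ≤ (c m : ℕ) := by exact_mod_cast hm2
    have hqm : 0 < q ^ (m + 1) := pow_pos hq0 _
    have e5 : (((shift n c m : ℕ) : ℝ) + 1) / q ^ (m + 1) ≤ (c m : ℕ) / q ^ (m + 1) := by gcongr
    have e6 : value q (shift (n + (m + 1)) c) / q ^ (m + 1) ≤ (C + 1) / q ^ (m + 1) := by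
      gcongr
      linarith
    have e7 : C / q ^ (m + 1) ≤ C / q := by
      gcongr
      exact le_self_pow₀ hq.le (by omega)
    rw [add_div] at e5 e6
    linarith
  have all : ∀ k n, value q (shift n c) - 1 ≤ (M / (q - 1)) / q ^ k := by
    intro k
    have hM : 0 ≤ (M : ℝ) / (q - 1) := div_nonneg (Nat.cast_nonneg _) (by linarith)
    induction k with
    | zero =>
      intro n
      have := value_le hq (shift n c)
      rw [pow_zero, div_one]
      linarith
    | succ k ih =>
      intro n
      have := step _ (by positivity) ih n
      rwa [div_div, ← pow_succ] at this
  have hlim : Filter.Tendsto (fun k : ℕ => (M / (q - 1)) / q ^ k) Filter.atTop (nhds 0) :=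
    tendsto_const_nhds.div_atTop (tendsto_pow_atTop_atTop_of_one_lt hq)
  have := ge_of_tendsto' hlim fun k => all k n
  linarith

theorem alpha_eq_of_value_eq_one {q : ℝ} (hq : q ∈ Ioc (1 : ℝ) (M + 1)) {c : Seqs M}
    (hc : IsInfinite c) (hmax : ∀ n, LexLe (shift n c) c) (h1 : value q c = 1) :
    alpha M q = c := by
  rw [alpha_eq hq]
  have hq0 : 0 < q := by linarith [hq.1]
  by_contra hne
  have hle := le_quasiGreedy hq.1 (sum_lt_one hq.1 hc h1)
  obtain ⟨n, hn1, hn2⟩ := hle.lt_of_ne (Ne.symm hne)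
  change ∀ j < n, c j = quasiGreedy M q j at hn1
  change c n < quasiGreedy M q n at hn2
  have e1 := value_eq_sum_add hq.1 c (n + 1)
  have e2 := sum_quasiGreedy_lt_one (M := M) hq.1 (n + 1)
  rw [Finset.sum_range_succ] at e1 e2
  rw [Finset.sum_congr rfl fun i hi => by rw [hn1 i (Finset.mem_range.1 hi)], h1] at e1
  have e3 := value_shift_le_one hq.1 hc hmax h1 (n + 1)
  have e4 : ((c n : ℕ) : ℝ) + 1 ≤ (quasiGreedy M q n : ℕ) := by exact_mod_cast hn2
  have hqm : 0 < q ^ (n + 1) := pow_pos hq0 _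
  have e5 : (((c n : ℕ) : ℝ) + 1) / q ^ (n + 1) ≤ (quasiGreedy M q n : ℕ) / q ^ (n + 1) := by
    gcongr
  have e6 : value q (shift (n + 1) c) / q ^ (n + 1) ≤ 1 / q ^ (n + 1) := by gcongr
  rw [add_div] at e5
  linarith

theorem exists_value_eq_one (hM : 1 ≤ M) {c : Seqs M} (hc : IsInfinite c) :
    ∃ q ∈ Ioc (1 : ℝ) (M + 1), value q c = 1 := by
  obtain ⟨n₁, -, h₁⟩ := hc 0
  obtain ⟨n₂, hn, h₂⟩ := hc (n₁ + 1)
  have hM' : (1 : ℝ) ≤ M := by exact_mod_cast hM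
  -- In the base `2 ^ (1 / (n₂ + 1))` the two digits alone contribute at least `1 / 2` each.
  set q₀ : ℝ := 2 ^ ((n₂ + 1 : ℕ) : ℝ)⁻¹ with hq₀
  have hpow : q₀ ^ (n₂ + 1) = 2 := Real.rpow_inv_natCast_pow (by norm_num) (by omega)
  have hq1 : 1 < q₀ := Real.one_lt_rpow (by norm_num) (by positivity)
  have hq2 : q₀ ≤ M + 1 := by
    have := le_self_pow₀ hq1.le (by omega : n₂ + 1 ≠ 0)
    linarith
  have hge : 1 ≤ value q₀ c := by
    have hdigit : ∀ n, c n ≠ 0 → n ≤ n₂ → 1 / 2 ≤ ((c n : ℕ) : ℝ) / q₀ ^ (n + 1) := by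
      intro n hn hle
      have h1 : (1 : ℝ) ≤ (c n : ℕ) := by
        exact_mod_cast Nat.one_le_iff_ne_zero.2 fun h => hn (Fin.ext h)
      have h2 : q₀ ^ (n + 1) ≤ 2 := by
        rw [← hpow]
        exact pow_le_pow_right₀ hq1.le (by omega)
      have h3 : 0 < q₀ ^ (n + 1) := by positivity
      gcongr
    have h := (summable_digits hq1 c).sum_le_tsum {n₁, n₂} fun i _ => by positivity
    rw [Finset.sum_pair (by omega)] at h
    have := hdigit n₁ h₁ (by omega)
    have := hdigit n₂ h₂ le_rfl
    rw [value]
    linarith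
  have hle : value ((M : ℝ) + 1) c ≤ 1 := by
    have := value_le (by linarith : (1 : ℝ) < M + 1) c
    rwa [add_sub_cancel_right, div_self (by linarith)] at this
  have hcont : ContinuousOn (fun q => value q c) (Icc q₀ (M + 1)) := by
    refine continuousOn_tsum (u := fun i => M / q₀ ^ (i + 1)) (fun i => ?_)
      (hasSum_const_div hq1 (M : ℝ)).summable fun i q hq => ?_
    · refine continuousOn_const.div (continuousOn_id.pow _) fun q hq => pow_ne_zero _ ?_
      have hq0 : 0 < q := by linarith [hq.1]
      exact hq0.ne'
    · have hq0 : 0 < q := by linarith [hq.1]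
      rw [Real.norm_of_nonneg (by positivity)]
      have := val_le c i
      have := hq.1
      gcongr
  obtain ⟨q, hq, h⟩ := intermediate_value_Icc' hq2 hcont ⟨hle, hge⟩
  exact ⟨q, ⟨hq1.trans_le hq.1, hq.2⟩, h⟩

theorem VSeqs.isInfinite (hM : 1 ≤ M) {c : Seqs M} (hc : c ∈ VSeqs M) : IsInfinite c := by
  intro N
  by_contra hcon
  push Not at hcon
  have h1 : (c 0).rev ≤ c N := (hc N).1.zero_le
  have h2 : (reflSeq c) = shift N c := by
    -- The shift is `0^∞`, the smallest sequence of all.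
    refine (hc N).1.antisymm ?_
    by_contra h
    obtain ⟨i, -, h⟩ := not_lexLe.1 h
    change reflSeq c i < c (N + i) at h
    rw [hcon (N + i) (by omega)] at h
    exact absurd h (by simp)
  have h3 := congrFun h2 N
  have h4 := congrFun h2 0
  change (c N).rev = c (N + N) at h3
  rw [hcon N le_rfl, hcon (N + N) (by omega), Fin.ext_iff, Fin.val_rev] at h3
  simp at h3
  omega

theorem exists_alpha_eq (hM : 1 ≤ M) {c : Seqs M} (hc : c ∈ VSeqs M) :
    ∃ q ∈ Ioc (1 : ℝ) (M + 1), alpha M q = c := by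
  obtain ⟨q, hq, h⟩ := exists_value_eq_one hM (VSeqs.isInfinite hM hc)
  exact ⟨q, hq, alpha_eq_of_value_eq_one hq (VSeqs.isInfinite hM hc) (fun n => (hc n).2) h⟩

theorem value_alpha {q : ℝ} (hq : q ∈ Ioc (1 : ℝ) (M + 1)) : value q (alpha M q) = 1 := by
  rw [alpha_eq hq]
  exact value_quasiGreedy hq.1 hq.2

theorem alpha_qG (hM : 1 ≤ M) : qG M ∈ Ioc (1 : ℝ) (M + 1) ∧ alpha M (qG M) = golden M := by
  obtain ⟨q, hq, h⟩ := exists_alpha_eq hM golden_mem_VSeqs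
  suffices qG M = q by rw [this]; exact ⟨hq, h⟩
  have hv := value_alpha hq
  rw [h] at hv
  have hq1 := hq.1
  have e1 := value_eq_zero_add hq1 (golden M)
  have e2 := value_eq_zero_add hq1 (shift 1 (golden M))
  have g1 : ((shift 1 (golden M) 0 : Fin (M + 1)) : ℕ) = M / 2 := val_golden_one M
  have g2 : shift 1 (shift 1 (golden M)) = golden M := by
    rw [shift_shift, shift_golden]
    simp
  rw [hv, val_golden_zero] at e1
  rw [g1, g2, hv] at e2
  rw [qG]
  split_ifs with hev
  · obtain ⟨k, rfl⟩ := hev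
    have h1 : (k + k + 1) / 2 = k := by omega
    have h2 : (k + k) / 2 = k := by omega
    rw [h1] at e1
    rw [h2] at e2 ⊢
    have h3 : (q + 1) * (q - (k + 1)) = 0 := by linear_combination q * e1 + e2
    rcases mul_eq_zero.1 h3 with h | h <;> linarith
  · have hodd := Nat.odd_iff.1 (Nat.not_even_iff_odd.1 hev)
    have h1 : (M + 1) / 2 = M / 2 + 1 := by omega
    rw [h1] at e1
    push_cast at e1
    generalize ((M / 2 : ℕ) : ℝ) = k at *
    have h3 : q ^ 2 - (k + 1) * q - (k + 1) = 0 := by linear_combination q * e1 + e2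
    have h4 : k ^ 2 + 6 * k + 5 = (2 * q - (k + 1)) ^ 2 := by linear_combination (-4) * h3
    have h5 : 0 ≤ 2 * q - (k + 1) := by
      have : 0 ≤ value q (shift 1 (golden M)) := value_nonneg hq1 _
      linarith
    rw [h4, Real.sqrt_sq h5]
    ring

/-! ### Compactness -/

theorem isSubshift_between (a : Seqs M) : IsSubshift (between a) := by
  refine ⟨{w | ∀ c ∈ between a, ¬ Occurs w c}, Set.ext fun c => ⟨fun hc w hw => hw c hc, ?_⟩⟩
  intro hc n
  -- Every factor of `c` occurs in some element of `between a`.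
  have key : ∀ l, ∃ d ∈ between a, Agree l d (shift n c) := by
    intro l
    by_contra hcon
    refine hc (pre (shift n c) l) (fun d hd hocc => hcon ?_) ⟨n, by simp⟩
    obtain ⟨m, hm⟩ := hocc
    rw [length_pre, pre_eq_pre_iff] at hm
    exact ⟨_, shift_mem_between hd m, hm⟩
  constructor
  · by_contra h
    obtain ⟨l, hl⟩ := lexLt_iff_exists_ltIn.1 (not_lexLe.1 h)
    obtain ⟨d, hd, hag⟩ := key l
    have := (hd 0).1
    rw [shift_zero] at this
    exact (hl.congr hag.symm (fun _ _ => rfl)).not_le this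
  · by_contra h
    obtain ⟨l, hl⟩ := lexLt_iff_exists_ltIn.1 (not_lexLe.1 h)
    obtain ⟨d, hd, hag⟩ := key l
    have := (hd 0).2
    rw [shift_zero] at this
    exact (hl.congr (fun _ _ => rfl) hag.symm).not_le this

theorem isClosed_setOf_lexLe (c : Seqs M) : IsClosed {d | LexLe c d} := by
  rw [← isOpen_compl_iff]
  have : {d | LexLe c d}ᶜ = ⋃ i, (⋂ j < i, {d : Seqs M | d j = c j}) ∩ {d | d i < c i} := by
    ext d
    simp only [mem_compl_iff, mem_ofPred_eq, not_lexLe, lexLt_iff, mem_iUnion, mem_inter_iff,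
      mem_iInter]
  rw [this]
  refine isOpen_iUnion fun i => IsOpen.inter ?_ ?_
  · refine (Set.finite_lt_nat i).isOpen_biInter fun j _ => ?_
    exact (isOpen_discrete {c j}).preimage (f := fun d : Seqs M => d j) (continuous_apply j)
  · exact (isOpen_discrete (Set.Iio (c i))).preimage (f := fun d : Seqs M => d i)
      (continuous_apply i)

theorem continuous_reflSeq : Continuous (reflSeq : Seqs M → Seqs M) :=
  continuous_pi fun i => continuous_of_discreteTopology.comp (continuous_apply i)

theorem isClosed_between (a : Seqs M) : IsClosed (between a) := by
  have h : between a = ⋂ n, ((shift n) ⁻¹' {d | LexLe (reflSeq a) d} ∩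
      (reflSeq ∘ shift n) ⁻¹' {d | LexLe (reflSeq a) d}) := by
    ext c
    simp only [between, mem_ofPred_eq, mem_iInter, mem_inter_iff, mem_preimage, Function.comp]
    refine forall_congr' fun n => and_congr_right fun _ => ⟨LexLe.reflSeq, fun h => ?_⟩
    have := h.reflSeq
    rwa [reflSeq_reflSeq, reflSeq_reflSeq] at this
  have hs : ∀ n, Continuous (shift n : Seqs M → Seqs M) := fun n =>
    continuous_pi fun i => continuous_apply (n + i)
  rw [h]
  exact isClosed_iInter fun n => ((isClosed_setOf_lexLe _).preimage (hs n)).inter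
    ((isClosed_setOf_lexLe _).preimage (continuous_reflSeq.comp (hs n)))

theorem exists_lexLe_max {X : Set (Seqs M)} (hX : IsClosed X) (hne : X.Nonempty) :
    ∃ b ∈ X, ∀ c ∈ X, LexLe c b := by
  have : Nonempty X := hne.to_subtype
  have hcl : ∀ c : X, IsClosed (X ∩ {d | LexLe c d}) := fun c =>
    hX.inter (isClosed_setOf_lexLe _)
  have hdir : Directed (· ⊇ ·) fun c : X => X ∩ {d | LexLe c d} := by
    intro c d
    rcases lexLe_total (c : Seqs M) d with h | h
    · exact ⟨d, fun x hx => ⟨hx.1, h.trans hx.2⟩, fun x hx => hx⟩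
    · exact ⟨c, fun x hx => hx, fun x hx => ⟨hx.1, h.trans hx.2⟩⟩
  have hmem : ∀ c : X, (X ∩ {d | LexLe c d}).Nonempty := fun c => ⟨c, c.2, lexLe_refl (c : Seqs M)⟩
  obtain ⟨b, hb⟩ := IsCompact.nonempty_iInter_of_directed_nonempty_isCompact_isClosed _ hdir hmem
    (fun c => (hcl c).isCompact) hcl
  rw [mem_iInter] at hb
  exact ⟨b, (hb ⟨_, hne.some_mem⟩).1, fun c hc => (hb ⟨c, hc⟩).2⟩

/-- If `between a` is nonempty, its largest element `b` is in `VSeqs M`, because the smallest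
one is the reflection of `b`; and `b` defines the same set as `a`. -/
theorem exists_VSeqs_between_eq {a : Seqs M} (hne : (between a).Nonempty) :
    ∃ b ∈ VSeqs M, LexLe b a ∧ between a = between b ∧ ∀ c ∈ between a, LexLe c b := by
  obtain ⟨b, hb, hmax⟩ := exists_lexLe_max (isClosed_between a) hne
  have hba : LexLe b a := by
    have := (hb 0).2
    rwa [shift_zero] at this
  have hsub : between a ⊆ between b := by
    intro c hc n
    refine ⟨?_, hmax _ (shift_mem_between hc n)⟩
    have := (hmax _ (reflSeq_mem_between (shift_mem_between hc n))).reflSeq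
    rwa [reflSeq_reflSeq] at this
  exact ⟨b, hsub hb, hba, hsub.antisymm (between_mono hba), hmax⟩

end UniqueExpansion

theorem theorem1 (M : ℕ) (hM : 1 ≤ M) :
    (∀ q ∈ Icc (qG M) ((M : ℝ) + 1), (VShift M q).Nonempty ∧ IsSubshift (VShift M q)) ∧
    (∀ q ∈ Ioc (1 : ℝ) ((M : ℝ) + 1), q < qG M → VShift M q = ∅) ∧
    ∃ qT ∈ Ioc (1 : ℝ) ((M : ℝ) + 1),
      (∀ p ∈ Ioc (1 : ℝ) ((M : ℝ) + 1), alpha M p = transitiveSeq M ↔ p = qT) ∧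
      (∀ q ∈ Icc (qG M) ((M : ℝ) + 1) ∩ VBases M,
        (IsTransitive (VShift M q) ↔ IsIrreducibleSeq (alpha M q) ∨ q = qT)) ∧
      (∀ q ∈ Icc (qG M) ((M : ℝ) + 1), ∃ p,
        IsGreatest (VBases M ∩ Icc (qG M) q) p ∧ VShift M q = VShift M p ∧
        (IsTransitive (VShift M q) ↔ IsIrreducibleSeq (alpha M p) ∨ p = qT)) := by
  obtain ⟨hG, hGalpha⟩ := alpha_qG hM
  have hIoc : ∀ q ∈ Icc (qG M) ((M : ℝ) + 1), q ∈ Ioc (1 : ℝ) (M + 1) := fun q hq =>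
    ⟨hG.1.trans_le hq.1, hq.2⟩
  have hnonempty : ∀ q ∈ Icc (qG M) ((M : ℝ) + 1), (VShift M q).Nonempty := by
    intro q hq
    refine ⟨golden M, golden_mem_between ?_⟩
    rw [← hGalpha]
    exact (alpha_le_alpha_iff hG (hIoc q hq)).2 hq.1
  obtain ⟨qT, hqT, hqTalpha⟩ := exists_alpha_eq hM (transitiveSeq_mem_VSeqs hM)
  have huniq : ∀ p ∈ Ioc (1 : ℝ) ((M : ℝ) + 1), alpha M p = transitiveSeq M ↔ p = qT := by
    refine fun p hp => ⟨fun h => ?_, fun h => h ▸ hqTalpha⟩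
    rw [← hqTalpha] at h
    exact le_antisymm ((alpha_le_alpha_iff hp hqT).1 (h ▸ lexLe_refl _))
      ((alpha_le_alpha_iff hqT hp).1 (h ▸ lexLe_refl _))
  have htrans : ∀ q ∈ VBases M,
      (IsTransitive (VShift M q) ↔ IsIrreducibleSeq (alpha M q) ∨ q = qT) := by
    rintro q ⟨hq, hqV⟩
    rw [← huniq q hq]
    exact isTransitive_iff hM hqV
  refine ⟨fun q hq => ⟨hnonempty q hq, isSubshift_between _⟩, fun q hq hlt => ?_, qT, hqT, huniq,
    fun q hq => htrans q hq.2, fun q hq => ?_⟩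
  · refine between_eq_empty_of_lt_golden ?_
    rw [← hGalpha]
    exact alpha_lt_alpha hq hG hlt
  · obtain ⟨b, hb, hba, heq, hmax⟩ := exists_VSeqs_between_eq (hnonempty q hq)
    obtain ⟨p, hp, rfl⟩ := exists_alpha_eq hM hb
    have hpV : p ∈ VBases M := ⟨hp, hb⟩
    have heq' : VShift M q = VShift M p := heq
    refine ⟨p, ⟨⟨hpV, ?_, (alpha_le_alpha_iff hp (hIoc q hq)).1 hba⟩, ?_⟩, heq', ?_⟩
    · refine (alpha_le_alpha_iff hG hp).1 ?_
      rw [hGalpha]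
      exact golden_le hb
    · rintro p' ⟨⟨hp', hV'⟩, -, hle⟩
      refine (alpha_le_alpha_iff hp' hp).1 (hmax _ ?_)
      exact between_mono ((alpha_le_alpha_iff hp' (hIoc q hq)).2 hle) hV'
    · rw [heq']
      exact htrans p hpV
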